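/- Let $H$ be a real Hilbert space with complexification $H_{\mathbb C}=H+iH$, let $t_f>0$, and let $A,A_1,A_2$ be (possibly unbounded) linear operators in $H$ such that: (A1) $A$ is densely defined; $(Av,v)_H>0$ for all $0\ne v\in\mathrm{dom}(A)$; $0\in\rho(A)$; and there are $\varphi\in(0,\frac\pi2)$ and $C>0$ such that every $\lambda\in\mathbb C$ with $\varphi<|\arg\lambda|\le\pi$ lies in $\rho(A)$ with $\|(A-\lambda I)^{-1}\|_{\mathcal L(H_{\mathbb C})}\le C/|\lambda|$; (A2) $\mathrm{dom}(A_1)\cap\mathrm{dom}(A_2)\subseteq\mathrm{dom}(A)$, with $A=A_1+A_2$ on this intersection, and for $\ell=1,2$ the operator $A_\ell A^{-1}:H\to H$ is well defined and bounded. Let $\mathrm e^{-tA}$ be the strongly continuous semigroup generated by $-A$. Let $A^{-\theta}$ be the fractional powers: $A^0=I$, $A^{-1}$ is the inverse, and $A^{-\theta}=\frac{\sin\pi\theta}{\pi}\int_0^\infty s^{-\theta}(sI+A)^{-1}\,ds$ for $0<\theta<1$. Let $I\subset(0,\infty)$. For each $h\in I$ let $V_h\subset H$ be a finite-dimensional subspace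 with a second norm $\|\cdot\|_{V_h}$ induced by an inner product, let $P_h:H\to V_h$ be a bounded projection onto $V_h$, and let $A_h,A_{h,1},A_{h,2}\in\mathcal L(V_h)$. Suppose that, with constants $c,C>0$ independent of $h\in I$: (D1) $\|P_h\|\le C$, $\|(I-P_h)v\|_H\le Ch^2\|Av\|_H$ for $v\in\mathrm{dom}(A)$, and $\|v_h\|_H\le C\|v_h\|_{V_h}$ for $v_h\in V_h$; (D2) $(A_hv_h,v_h)_H\ge c\|v_h\|_{V_h}^2$ and $|(A_hv_h,w_h)_H|\le C\|v_h\|_{V_h}\|w_h\|_{V_h}$ for $v_h,w_h\in V_h$; (D3) $A_h=A_{h,1}+A_{h,2}$, and $(A_{h,\ell}v_h,v_h)_H\ge0$ for $v_h\in V_h$, $\ell=1,2$; (D4) $\|A_{h,\ell}P_h\|_{\mathcal L(H)}\le Ch^{-2}$, and $\|(P_hA_\ell-A_{h,\ell}P_h)v\|_H\le C\|Av\|_H$ for $v\in\mathrm{dom}(A)$, $\ell=1,2$; (D5) $\|A^{-1}-A_h^{-1}P_h\|_{\mathcal L(H)}\le Ch^2$. For $\tau>0$ put $S_{h,\tau}=(I+\tau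 A_{h,2})^{-1}(I+\tau A_{h,1})^{-1}(I+\tau^2A_{h,1}A_{h,2})$. Then there is a constant $C>0$ such that for all $h\in I$, $N\in\mathbb N$, $n\in\{1,\dots,N\}$ and $\theta,\zeta\in[0,1]$, with $\tau=t_f/N$ and $t_n=n\tau$, $$\big\|\big(\mathrm e^{-t_nA}-S_{h,\tau}^{n-1}(I+\tau A_{h,2})^{-1}(I+\tau A_{h,1})^{-1}P_h\big)A^{-\theta}\big\|_{\mathcal L(H)}\le C\Big((1+\ln n)\,\tau^{\theta}+t_n^{-\zeta(1-\theta)}h^{2\theta+2\zeta(1-\theta)}\Big).$$ -/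

import Mathlib

noncomputable section

namespace DRSplitting

open Filter Topology

variable {H : Type*} [NormedAddCommGroup H] [InnerProductSpace ℝ H]

/-! ### Unbounded operators, inverses and resolvents -/

/-- `R` is the everywhere defined, bounded, two-sided inverse of the (unbounded) operator `T`. -/
def IsBoundedInverse {E : Type*} [NormedAddCommGroup E] [NormedSpace ℝ E]
    (T : E →ₗ.[ℝ] E) (R : E →L[ℝ] E) : Prop :=
  (∀ y : E, ∃ hy : R y ∈ T.domain, T ⟨R y, hy⟩ = y) ∧ (∀ x : T.domain, R (T x) = x)

open Classical in
/-- The bounded inverse `T⁻¹ ∈ L(E)` of an (unbounded) operator, if there is one (else `0`). -/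
def boundedInverse {E : Type*} [NormedAddCommGroup E] [NormedSpace ℝ E]
    (T : E →ₗ.[ℝ] E) : E →L[ℝ] E :=
  if h : ∃ R : E →L[ℝ] E, IsBoundedInverse T R then h.choose else 0

/-- The complexification `H + iH`, with `‖x + iy‖² = ‖x‖² + ‖y‖²`; the pair `(x, y)` is `x + iy`. -/
abbrev Complexification (H : Type*) [NormedAddCommGroup H] : Type _ := WithLp 2 (H × H)

/-- Multiplication by the complex number `z` on `H + iH`:
`z (x + iy) = (Re z x - Im z y) + i (Im z x + Re z y)`. -/
def complexMul (z : ℂ) : Complexification H →ₗ[ℝ] Complexification H where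
  toFun w := WithLp.toLp 2 (z.re • w.fst - z.im • w.snd, z.im • w.fst + z.re • w.snd)
  map_add' u v := by
    refine WithLp.ofLp_injective 2 (Prod.ext ?_ ?_) <;> simp [smul_add] <;> abel
  map_smul' c u := by
    refine WithLp.ofLp_injective 2 (Prod.ext ?_ ?_) <;>
      simp [smul_sub, smul_add, smul_smul, mul_comm]

/-- The complexified operator `A (x + iy) = A x + i A y` with domain `dom A + i dom A`. -/
def complexify (A : H →ₗ.[ℝ] H) : Complexification H →ₗ.[ℝ] Complexification H where
  domain :=
    (A.domain.prod A.domain).comap (WithLp.linearEquiv 2 ℝ (H × H)).toLinearMap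
  toFun :=
    { toFun := fun w => WithLp.toLp 2 (A ⟨w.1.fst, w.2.1⟩, A ⟨w.1.snd, w.2.2⟩)
      map_add' := fun u v => by
        refine WithLp.ofLp_injective 2 (Prod.ext ?_ ?_)
        · exact A.map_add ⟨u.1.fst, u.2.1⟩ ⟨v.1.fst, v.2.1⟩
        · exact A.map_add ⟨u.1.snd, u.2.2⟩ ⟨v.1.snd, v.2.2⟩
      map_smul' := fun c u => by
        refine WithLp.ofLp_injective 2 (Prod.ext ?_ ?_)
        · exact A.map_smul c ⟨u.1.fst, u.2.1⟩
        · exact A.map_smul c ⟨u.1.snd, u.2.2⟩ }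

/-- The operator `A - z I` on `H + iH`, with domain `dom A + i dom A`. -/
def complexShift (A : H →ₗ.[ℝ] H) (z : ℂ) : Complexification H →ₗ.[ℝ] Complexification H :=
  (-complexMul (H := H) z) +ᵥ complexify A

/-- The operator `A + s I` on `H`, with domain `dom A`. -/
def realShift (A : H →ₗ.[ℝ] H) (s : ℝ) : H →ₗ.[ℝ] H :=
  (s • (LinearMap.id : H →ₗ[ℝ] H)) +ᵥ A

/-! ### The semigroup `e^{-tA}` and the powers `A^{-θ}` -/

/-- `T` (restricted to `[0, ∞)`) is a strongly continuous semigroup of bounded operators. -/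
structure IsC0Semigroup (T : ℝ → H →L[ℝ] H) : Prop where
  zero : T 0 = 1
  add : ∀ s t : ℝ, 0 ≤ s → 0 ≤ t → T (s + t) = T s ∘L T t
  cont : ∀ x : H, Tendsto (fun t => T t x) (𝓝[>] 0) (𝓝 x)

/-- `B` is the infinitesimal generator of `T`: `x ∈ dom B` and `B x = y` if and only if
`(T(t) x - x) / t → y` as `t ↓ 0`. -/
def IsGenerator (T : ℝ → H →L[ℝ] H) (B : H →ₗ.[ℝ] H) : Prop :=
  ∀ x y : H, (x, y) ∈ B.graph ↔ Tendsto (fun t : ℝ => t⁻¹ • (T t x - x)) (𝓝[>] 0) (𝓝 y)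

open Classical in
/-- `e^{-tA}`, `t ≥ 0`: the strongly continuous semigroup generated by `-A`
(the value is `0` if `-A` generates no such semigroup). -/
def expNeg (A : H →ₗ.[ℝ] H) (t : ℝ) : H →L[ℝ] H :=
  if h : ∃ T : ℝ → H →L[ℝ] H, IsC0Semigroup T ∧ IsGenerator T (-A) then h.choose t else 0

/-- The power `A^{-θ}`, `θ ∈ [0, 1]`: `A^0 = I`, `A^{-1}` is the inverse, and for `0 < θ < 1`
`A^{-θ} = (sin πθ / π) ∫₀^∞ s^{-θ} (s I + A)^{-1} ds`. -/
def negPow (A : H →ₗ.[ℝ] H) (θ : ℝ) : H →L[ℝ] H :=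
  if θ = 0 then 1
  else if θ = 1 then boundedInverse A
  else (Real.sin (Real.pi * θ) / Real.pi) •
    ∫ s in Set.Ioi (0 : ℝ), s ^ (-θ) • boundedInverse (realShift A s)

/-! ### Assumptions on the continuous operators -/

/-- `A` is densely defined, positive and sectorial with an angle `φ ∈ (0, π/2)`, and `0 ∈ ρ(A)`. -/
structure IsPositiveSectorial (A : H →ₗ.[ℝ] H) : Prop where
  dense : Dense (A.domain : Set H)
  positive : ∀ v : A.domain, (v : H) ≠ 0 → 0 < inner ℝ (A v) (v : H)
  zero_mem_resolvent : ∃ R : H →L[ℝ] H, IsBoundedInverse A R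
  sectorial : ∃ φ : ℝ, 0 < φ ∧ φ < Real.pi / 2 ∧ ∃ C : ℝ, 0 < C ∧
    ∀ z : ℂ, φ < |z.arg| →
      ∃ R : Complexification H →L[ℝ] Complexification H,
        IsBoundedInverse (complexShift A z) R ∧ ‖R‖ ≤ C / ‖z‖

/-- `B A⁻¹ : H → H` is well defined and bounded. -/
def RelativelyBounded (B A : H →ₗ.[ℝ] H) : Prop :=
  ∃ G : H →L[ℝ] H, ∀ y : H, ∃ hy : boundedInverse A y ∈ B.domain, B ⟨boundedInverse A y, hy⟩ = G y

/-- The standing assumption on `A` and its splitting into `A₁` and `A₂`. -/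
structure SplitOperators (A A₁ A₂ : H →ₗ.[ℝ] H) : Prop where
  /-- `dom A₁ ∩ dom A₂ ⊆ dom A`, and `A = A₁ + A₂` there. -/
  sum_le : A₁ + A₂ ≤ A
  sectorial : IsPositiveSectorial A
  bounded₁ : RelativelyBounded A₁ A
  bounded₂ : RelativelyBounded A₂ A

/-! ### The discretization -/

/-- The data of the spatial discretization: finite-dimensional subspaces `V_h ⊆ H`, projections
`P_h` of `H` onto `V_h`, a second inner product on each `V_h`, and operators
`A_h, A_{h,1}, A_{h,2} ∈ L(V_h)`, for `h` in a set `I ⊆ (0, ∞)`. -/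
structure SpatialDiscretization (H : Type*) [NormedAddCommGroup H] [InnerProductSpace ℝ H] where
  I : Set ℝ
  I_pos : ∀ h ∈ I, 0 < h
  V : I → Submodule ℝ H
  finiteDimensional : ∀ h, FiniteDimensional ℝ (V h)
  P : (h : I) → H →L[ℝ] V h
  P_proj : ∀ (h : I) (v : V h), P h (v : H) = v
  innerV : (h : I) → InnerProductSpace.Core ℝ (V h)
  Ah : (h : I) → V h →L[ℝ] V h
  Ah₁ : (h : I) → V h →L[ℝ] V h
  Ah₂ : (h : I) → V h →L[ℝ] V h

namespace SpatialDiscretization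

variable (D : SpatialDiscretization H)

/-- The norm `‖·‖_{V_h}` induced by the second inner product on `V_h`. -/
def normV (h : D.I) (v : D.V h) : ℝ := Real.sqrt ((D.innerV h).inner v v)

/-- An operator on `V_h`, applied after `P_h` and regarded as an operator on `H`. -/
def lift (h : D.I) (T : D.V h →L[ℝ] D.V h) : H →L[ℝ] H := (D.V h).subtypeL ∘L T ∘L D.P h

/-- The projections are bounded uniformly in `h`, and `‖(I - P_h) v‖ ≤ C h² ‖A v‖` on `dom A`. -/
structure ProjectionAssumption (A : H →ₗ.[ℝ] H) : Prop where
  bounded : ∃ C : ℝ, 0 < C ∧ ∀ h : D.I, ‖D.P h‖ ≤ C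
  error : ∃ C : ℝ, 0 < C ∧ ∀ (h : D.I) (v : A.domain),
    ‖(v : H) - (D.P h (v : H) : H)‖ ≤ C * (h : ℝ) ^ 2 * ‖A v‖

/-- `‖(P_h B - B_h P_h) v‖ ≤ C ‖A v‖` for all `v ∈ dom A` (where `dom A ⊆ dom B`). -/
def Exchange (A B : H →ₗ.[ℝ] H) (Bh : (h : D.I) → D.V h →L[ℝ] D.V h) : Prop :=
  ∃ C : ℝ, 0 < C ∧ ∀ (h : D.I) (v : A.domain), ∃ hv : (v : H) ∈ B.domain,
    ‖D.P h (B ⟨(v : H), hv⟩) - Bh h (D.P h (v : H))‖ ≤ C * ‖A v‖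

/-- The assumption on the discrete operators; every constant is independent of `h`.
By coercivity `A_h` is invertible, so `Ring.inverse (D.Ah h)` is its inverse. -/
structure DiscreteOperatorAssumption (A A₁ A₂ : H →ₗ.[ℝ] H) : Prop where
  norm_le : ∃ C : ℝ, 0 < C ∧ ∀ (h : D.I) (v : D.V h), ‖(v : H)‖ ≤ C * D.normV h v
  coercive : ∃ c : ℝ, 0 < c ∧ ∀ (h : D.I) (v : D.V h),
    c * D.normV h v ^ 2 ≤ inner ℝ (D.Ah h v : H) (v : H)
  bounded : ∃ C : ℝ, 0 < C ∧ ∀ (h : D.I) (v w : D.V h),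
    |inner ℝ (D.Ah h v : H) (w : H)| ≤ C * D.normV h v * D.normV h w
  sum : ∀ h : D.I, D.Ah h = D.Ah₁ h + D.Ah₂ h
  nonneg₁ : ∀ (h : D.I) (v : D.V h), 0 ≤ inner ℝ (D.Ah₁ h v : H) (v : H)
  nonneg₂ : ∀ (h : D.I) (v : D.V h), 0 ≤ inner ℝ (D.Ah₂ h v : H) (v : H)
  inverseEstimate₁ : ∃ C : ℝ, 0 < C ∧ ∀ h : D.I, ‖D.lift h (D.Ah₁ h)‖ ≤ C * ((h : ℝ) ^ 2)⁻¹
  inverseEstimate₂ : ∃ C : ℝ, 0 < C ∧ ∀ h : D.I, ‖D.lift h (D.Ah₂ h)‖ ≤ C * ((h : ℝ) ^ 2)⁻¹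
  exchange₁ : D.Exchange A A₁ D.Ah₁
  exchange₂ : D.Exchange A A₂ D.Ah₂
  approx : ∃ C : ℝ, 0 < C ∧ ∀ h : D.I,
    ‖boundedInverse A - D.lift h (Ring.inverse (D.Ah h))‖ ≤ C * (h : ℝ) ^ 2

/-- `(I + τ A_{h,1})⁻¹`; the inverse exists for `τ > 0` since `A_{h,1}` is non-negative. -/
def res₁ (h : D.I) (τ : ℝ) : D.V h →L[ℝ] D.V h := Ring.inverse (1 + τ • D.Ah₁ h)

/-- `(I + τ A_{h,2})⁻¹`; the inverse exists for `τ > 0` since `A_{h,2}` is non-negative. -/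
def res₂ (h : D.I) (τ : ℝ) : D.V h →L[ℝ] D.V h := Ring.inverse (1 + τ • D.Ah₂ h)

/-- `S_{h,τ} = (I + τ A_{h,2})⁻¹ (I + τ A_{h,1})⁻¹ (I + τ² A_{h,1} A_{h,2})`. -/
def S (h : D.I) (τ : ℝ) : D.V h →L[ℝ] D.V h :=
  D.res₂ h τ * D.res₁ h τ * (1 + τ ^ 2 • (D.Ah₁ h * D.Ah₂ h))

/-- `S_{h,τ}^{n-1} (I + τ A_{h,2})⁻¹ (I + τ A_{h,1})⁻¹ P_h` as an operator on `H`, for `n ≥ 1`. -/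
def propagator (h : D.I) (τ : ℝ) (n : ℕ) : H →L[ℝ] H :=
  D.lift h (D.S h τ ^ (n - 1) * D.res₂ h τ * D.res₁ h τ)

end SpatialDiscretization

end DRSplitting

end

/-!
The proof works with the bounded operators `B = A⁻¹` and `B_h = A_h⁻¹ P_h`, which satisfy
`‖B - B_h‖ ≤ C h²`, and inserts implicit Euler between the semigroup and the scheme. With
`r = (I + τ A)⁻¹` and `ρ = (I + τ A_h)⁻¹ P_h`, the error is
`(e^{-t A} - rⁿ) + (rⁿ - ρⁿ) + (ρⁿ - S^{n-1} (I + τ A_{h,2})⁻¹ (I + τ A_{h,1})⁻¹ P_h)`.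

* Everything rests on the smoothing `‖ρʲ (1 - ρ)‖ ≤ M / (j + 1)`. Since `A_h` is coercive and
  bounded in one and the same norm, it follows from a Lyapunov function for implicit Euler
  (`lyapunov_implicitEuler`), with a constant independent of `h` and `τ`. If `h` may tend to zero,
  then `ρ → r` in norm, and `r` has the same smoothing (`isSmoothing_eulerStep`); if `h` stays away
  from zero, so does the right-hand side of the estimate, and stability suffices
  (`hasErrorBound_of_le`).
* For the error in space, `τ (r - ρ) = (1 - ρ) (B - B_h) (1 - r)` turns smoothing into
  `‖(rⁿ - ρⁿ) B‖ ≤ C h²` and `‖rⁿ - ρⁿ‖ ≤ C h² / t` (`norm_pow_sub_pow_mul_le`,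
  `norm_pow_sub_pow_le`).
* For the error in time, the semigroup exists by Yosida approximation (`exists_semigroup`), and the
  telescoping sum of the local errors gives `‖(e^{-t A} - rⁿ) B‖ ≤ C (1 + ln n) τ`.
* For the splitting error, `S` is conjugate by `(I + τ A_{h,2})⁻¹` to `½ (1 + C₁ C₂)` with two
  Cayley transforms, so that the scheme is stable. Its local errors contain `τ² A_{h,1} A_{h,2}`
  applied to smooth data, where `τ A_{h,1}` is absorbed by the scheme, and `A_{h,2} A_h⁻¹` is
  bounded. The telescoping sum yields `C (1 + ln n) τ` again (`norm_drStep_pow_mul_sub_mul_le`,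
  `exists_norm_propagator_sub_mul_le`).

The bounds for `X` and for `X A⁻¹` with these errors `X` are interpolated by the integral that
defines `A^{-θ}` (`norm_comp_negPow_le`).
-/

namespace DRSplitting

open Filter Topology

/-! ### Implicit Euler under a perturbation of the inverse operator -/

section ImplicitEuler

lemma norm_mul₃_le_of_le {𝔸 : Type*} [NormedRing 𝔸] {a b c : 𝔸} {x y z : ℝ}
    (ha : ‖a‖ ≤ x) (hb : ‖b‖ ≤ y) (hc : ‖c‖ ≤ z) : ‖a * b * c‖ ≤ x * y * z :=
  norm_mul_le_of_le (norm_mul_le_of_le ha hb) hc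

variable {𝔸 : Type*} [NormedRing 𝔸] [NormedAlgebra ℝ 𝔸]

/-- `r = (1 + τ B⁻¹)⁻¹`, expressed through the bounded operator `B` alone, so that it makes sense
also when `B` is not injective: `B (1 - r) = τ r = (1 - r) B`. -/
structure IsImplicitEuler (τ : ℝ) (B r : 𝔸) : Prop where
  left : B * (1 - r) = τ • r
  right : (1 - r) * B = τ • r

/-- The discrete analyticity of an implicit Euler step, together with its power boundedness. -/
structure IsSmoothing (M : ℝ) (r : 𝔸) : Prop where
  pow_le : ∀ j : ℕ, ‖r ^ j‖ ≤ M
  diff_le : ∀ j : ℕ, ‖r ^ j * (1 - r)‖ ≤ M / (j + 1)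

namespace IsImplicitEuler

variable {τ : ℝ} {B B' r ρ : 𝔸}

lemma comm (h : IsImplicitEuler τ B r) : Commute B r := by
  have h1 := h.left.trans h.right.symm
  have h2 : B * r = r * B := by
    have : B - B * r = B - r * B := by simpa [mul_sub, sub_mul] using h1
    exact sub_right_injective this
  exact h2

lemma smul_sub_eq (h : IsImplicitEuler τ B r) (h' : IsImplicitEuler τ B' ρ) :
    τ • (r - ρ) = (1 - ρ) * (B - B') * (1 - r) := by
  have : (1 - ρ) * (B - B') * (1 - r)
      = (1 - ρ) * (B * (1 - r)) - ((1 - ρ) * B') * (1 - r) := by noncomm_ring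
  rw [this, h.left, h'.right, mul_smul_comm, smul_mul_assoc, ← smul_sub]
  congr 1
  noncomm_ring

lemma sub_mul_eq (hτ : τ ≠ 0) (h : IsImplicitEuler τ B r) (h' : IsImplicitEuler τ B' ρ) :
    (r - ρ) * B = (1 - ρ) * (B - B') * r := by
  have h1 : τ • ((r - ρ) * B) = τ • ((1 - ρ) * (B - B') * r) := by
    rw [← smul_mul_assoc, smul_sub_eq h h', mul_assoc, h.right, mul_smul_comm]
  exact smul_right_injective _ hτ h1

lemma mul_sub_eq (hτ : τ ≠ 0) (h : IsImplicitEuler τ B r) (h' : IsImplicitEuler τ B' ρ) :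
    B' * (r - ρ) = ρ * (B - B') * (1 - r) := by
  have h1 : τ • (B' * (r - ρ)) = τ • (ρ * (B - B') * (1 - r)) := by
    rw [← mul_smul_comm, smul_sub_eq h h', ← mul_assoc, ← mul_assoc, h'.left, smul_mul_assoc,
      smul_mul_assoc]
  exact smul_right_injective _ hτ h1

end IsImplicitEuler

variable {τ δ M : ℝ} {B B' r ρ : 𝔸}

/-- The telescoping sum for `(rᵇ - ρᵇ) B`, in which the smoothing of `ρ` gains `1 / (a + 1)`. -/
lemma norm_pow_mul_pow_sub_pow_mul_le (hτ : τ ≠ 0)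
    (h : IsImplicitEuler τ B r) (h' : IsImplicitEuler τ B' ρ)
    (hr : IsSmoothing M r) (hρ : IsSmoothing M ρ) (hB : ‖B - B'‖ ≤ δ) (b : ℕ) :
    ∀ a : ℕ, ‖ρ ^ a * (r ^ b - ρ ^ b) * B‖ ≤ b * (M / (a + 1) * δ * M) := by
  have hM : 0 ≤ M := (norm_nonneg _).trans (hr.pow_le 0)
  have hδ : 0 ≤ δ := (norm_nonneg _).trans hB
  induction b with
  | zero => simp
  | succ b ih =>
    intro a
    have e : ρ ^ a * (r ^ (b + 1) - ρ ^ (b + 1)) * B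
        = ρ ^ (a + 1) * (r ^ b - ρ ^ b) * B
          + (ρ ^ a * (1 - ρ)) * (B - B') * r ^ (b + 1) := by
      have e1 : (r - ρ) * r ^ b * B = (1 - ρ) * (B - B') * r ^ (b + 1) := by
        rw [mul_assoc, ((h.comm.pow_right b).eq).symm, ← mul_assoc, h.sub_mul_eq hτ h', mul_assoc,
          ← pow_succ']
      calc _ = ρ ^ (a + 1) * (r ^ b - ρ ^ b) * B + ρ ^ a * ((r - ρ) * r ^ b * B) := by
            rw [pow_succ' r, pow_succ' ρ b, pow_succ ρ a]; noncomm_ring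
        _ = _ := by rw [e1]; noncomm_ring
    rw [e]
    refine (norm_add_le_of_le (ih (a + 1))
      (norm_mul₃_le_of_le (hρ.diff_le a) hB (hr.pow_le (b + 1)))).trans ?_
    have : M / ((a + 1 : ℕ) + 1 : ℝ) ≤ M / (a + 1) := by
      push_cast; gcongr; linarith
    calc _ ≤ b * (M / (a + 1) * δ * M) + M / (a + 1) * δ * M := by gcongr
      _ = _ := by push_cast; ring

/-- The telescoping sum for `B' (rᵃ - ρᵃ)`, in which the smoothing of `r` gains `1 / (b + 1)`. -/
lemma norm_mul_pow_sub_pow_mul_pow_le (hτ : τ ≠ 0)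
    (h : IsImplicitEuler τ B r) (h' : IsImplicitEuler τ B' ρ)
    (hr : IsSmoothing M r) (hρ : IsSmoothing M ρ) (hB : ‖B - B'‖ ≤ δ) (a : ℕ) :
    ∀ b : ℕ, ‖B' * (r ^ a - ρ ^ a) * r ^ b‖ ≤ a * (M * δ * (M / (b + 1))) := by
  have hM : 0 ≤ M := (norm_nonneg _).trans (hr.pow_le 0)
  have hδ : 0 ≤ δ := (norm_nonneg _).trans hB
  induction a with
  | zero => simp
  | succ a ih =>
    intro b
    have e : B' * (r ^ (a + 1) - ρ ^ (a + 1)) * r ^ b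
        = B' * (r ^ a - ρ ^ a) * r ^ (b + 1)
          + ρ ^ (a + 1) * (B - B') * (r ^ b * (1 - r)) := by
      have e1 : B' * ρ ^ a * (r - ρ) = ρ ^ (a + 1) * (B - B') * (1 - r) := by
        rw [(h'.comm.pow_right a).eq, mul_assoc, h.mul_sub_eq hτ h', pow_succ]; noncomm_ring
      have e2 : (1 - r) * r ^ b = r ^ b * (1 - r) := by
        rw [sub_mul, mul_sub, ← pow_succ, ← pow_succ']; simp
      calc _ = B' * (r ^ a - ρ ^ a) * r ^ (b + 1) + B' * ρ ^ a * (r - ρ) * r ^ b := by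
            rw [pow_succ r a, pow_succ ρ a, pow_succ' r b]; noncomm_ring
        _ = _ := by rw [e1, mul_assoc _ (1 - r), e2]
    rw [e]
    refine (norm_add_le_of_le (ih (b + 1))
      (norm_mul₃_le_of_le (hρ.pow_le (a + 1)) hB (hr.diff_le b))).trans ?_
    have : M / ((b + 1 : ℕ) + 1 : ℝ) ≤ M / (b + 1) := by
      push_cast; gcongr; linarith
    calc _ ≤ a * (M * δ * (M / (b + 1))) + M * δ * (M / (b + 1)) := by gcongr
      _ = _ := by push_cast; ring

/-- The error of implicit Euler under a perturbation of `B`, for smooth data. Cutting the `n` steps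
in two halves and using in each half the telescoping sum that is free of the singular end avoids a
logarithm. -/
lemma norm_pow_sub_pow_mul_le (hτ : τ ≠ 0)
    (h : IsImplicitEuler τ B r) (h' : IsImplicitEuler τ B' ρ)
    (hr : IsSmoothing M r) (hρ : IsSmoothing M ρ) (hB : ‖B - B'‖ ≤ δ) (n : ℕ) :
    ‖(r ^ n - ρ ^ n) * B‖ ≤ 4 * M ^ 2 * δ := by
  have hM : 0 ≤ M := (norm_nonneg _).trans (hr.pow_le 0)
  have hδ : 0 ≤ δ := (norm_nonneg _).trans hB
  obtain ⟨a, b, rfl, hab, hba⟩ : ∃ a b : ℕ, n = a + b ∧ a ≤ b + 1 ∧ b ≤ a + 1 :=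
    ⟨n / 2, n - n / 2, by omega, by omega, by omega⟩
  have hab' : (a : ℝ) ≤ b + 1 := by exact_mod_cast hab
  have hba' : (b : ℝ) ≤ a + 1 := by exact_mod_cast hba
  have e : (r ^ (a + b) - ρ ^ (a + b)) * B
      = ρ ^ a * (r ^ b - ρ ^ b) * B + (B' * (r ^ a - ρ ^ a) * r ^ b
        + 1 * (B - B') * r ^ (a + b) - ρ ^ a * (B - B') * r ^ b) := by
    have e1 : (r ^ a - ρ ^ a) * B = B' * (r ^ a - ρ ^ a) + (B - B') * r ^ a - ρ ^ a * (B - B') := by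
      have := (h.comm.pow_right a).eq
      have := (h'.comm.pow_right a).eq
      simp only [mul_sub, sub_mul]
      rw [‹B * r ^ a = _›, ‹B' * ρ ^ a = _›]; abel
    have e2 : (r ^ (a + b) - ρ ^ (a + b)) * B
        = ρ ^ a * (r ^ b - ρ ^ b) * B + (r ^ a - ρ ^ a) * (r ^ b * B) := by
      rw [pow_add, pow_add]; noncomm_ring
    rw [e2, ← (h.comm.pow_right b).eq, ← mul_assoc (r ^ a - ρ ^ a), e1, pow_add]
    noncomm_ring
  rw [e]
  have h1 : b * (M / (a + 1) * δ * M) ≤ M ^ 2 * δ := by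
    calc _ = (b / (a + 1)) * (M ^ 2 * δ) := by ring
      _ ≤ 1 * (M ^ 2 * δ) := by
        gcongr
        exact (div_le_one (by positivity)).2 hba'
      _ = _ := one_mul _
  have h2 : a * (M * δ * (M / (b + 1))) ≤ M ^ 2 * δ := by
    calc _ = (a / (b + 1)) * (M ^ 2 * δ) := by ring
      _ ≤ 1 * (M ^ 2 * δ) := by
        gcongr
        exact (div_le_one (by positivity)).2 hab'
      _ = _ := one_mul _
  have h3 : ‖(1 : 𝔸) * (B - B') * r ^ (a + b)‖ ≤ M * δ * M :=
    norm_mul₃_le_of_le (by simpa using hr.pow_le 0) hB (hr.pow_le _)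
  have h4 : ‖ρ ^ a * (B - B') * r ^ b‖ ≤ M * δ * M :=
    norm_mul₃_le_of_le (hρ.pow_le _) hB (hr.pow_le _)
  refine (norm_add_le_of_le (norm_pow_mul_pow_sub_pow_mul_le hτ h h' hr hρ hB b a)
    (norm_sub_le_of_le (norm_add_le_of_le
      (norm_mul_pow_sub_pow_mul_pow_le hτ h h' hr hρ hB a b) h3) h4)).trans ?_
  linarith

/-- The error of implicit Euler under a perturbation of `B`, for nonsmooth data. It follows from
the estimate for smooth data on either half of the `n` steps and the smoothing on the other. -/
lemma norm_pow_sub_pow_le (hτ : 0 < τ)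
    (h : IsImplicitEuler τ B r) (h' : IsImplicitEuler τ B' ρ)
    (hr : IsSmoothing M r) (hρ : IsSmoothing M ρ) (hB : ‖B - B'‖ ≤ δ) {n : ℕ} (hn : 1 ≤ n) :
    ‖r ^ n - ρ ^ n‖ ≤ 30 * (M ^ 2 + M ^ 3) * δ / (n * τ) := by
  have hM : 0 ≤ M := (norm_nonneg _).trans (hr.pow_le 0)
  have hδ : 0 ≤ δ := (norm_nonneg _).trans hB
  have hnτ : 0 < n * τ := by positivity
  rw [le_div_iff₀ hnτ]
  suffices hs : ‖τ • (r ^ n - ρ ^ n)‖ ≤ 30 * (M ^ 2 + M ^ 3) * δ / n by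
    rw [norm_smul, Real.norm_of_nonneg hτ.le, le_div_iff₀ (by positivity)] at hs
    linarith
  rcases hn.eq_or_lt with rfl | hn2
  · rw [pow_one, pow_one, h.smul_sub_eq h']
    have h1 : ‖1 - r‖ ≤ M := by simpa using hr.diff_le 0
    have h2 : ‖1 - ρ‖ ≤ M := by simpa using hρ.diff_le 0
    refine (norm_mul₃_le_of_le h2 hB h1).trans ?_
    have : 0 ≤ M ^ 2 * δ := by positivity
    have : 0 ≤ M ^ 3 * δ := by positivity
    push_cast
    linarith
  obtain ⟨a, b, rfl, hab, hba⟩ : ∃ a b : ℕ, n = (a + 1) + (b + 1) ∧ a ≤ b + 1 ∧ b ≤ a + 1 :=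
    ⟨(n - 2) / 2, n - 2 - (n - 2) / 2, by omega, by omega, by omega⟩
  have hab' : (a : ℝ) ≤ b + 1 := by exact_mod_cast hab
  have hba' : (b : ℝ) ≤ a + 1 := by exact_mod_cast hba
  have k1 : B' * (r ^ (b + 1) - ρ ^ (b + 1)) = (r ^ (b + 1) - ρ ^ (b + 1)) * B
      - 1 * (B - B') * r ^ (b + 1) + ρ ^ (b + 1) * (B - B') * 1 := by
    have := (h.comm.pow_right (b + 1)).eq
    have := (h'.comm.pow_right (b + 1)).eq
    simp only [mul_sub, sub_mul, one_mul, mul_one]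
    rw [‹B * r ^ _ = _›, ‹B' * ρ ^ _ = _›]; abel
  have hM1 : ‖(1 : 𝔸)‖ ≤ M := by simpa using hr.pow_le 0
  have k2 : ‖B' * (r ^ (b + 1) - ρ ^ (b + 1))‖ ≤ 6 * M ^ 2 * δ := by
    rw [k1]
    refine (norm_add_le_of_le (norm_sub_le_of_le (norm_pow_sub_pow_mul_le hτ.ne' h h' hr hρ hB _)
      (norm_mul₃_le_of_le hM1 hB (hr.pow_le _)))
      (norm_mul₃_le_of_le (hρ.pow_le _) hB hM1)).trans ?_
    linarith
  have e : τ • (r ^ ((a + 1) + (b + 1)) - ρ ^ ((a + 1) + (b + 1)))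
      = ((r ^ (a + 1) - ρ ^ (a + 1)) * B) * (r ^ b * (1 - r))
        + (ρ ^ a * (1 - ρ)) * (B' * (r ^ (b + 1) - ρ ^ (b + 1))) := by
    have e1 : B * (r ^ b * (1 - r)) = τ • r ^ (b + 1) := by
      rw [← mul_assoc, (h.comm.pow_right b).eq, mul_assoc, h.left, mul_smul_comm, ← pow_succ]
    have e2 : (ρ ^ a * (1 - ρ)) * B' = τ • ρ ^ (a + 1) := by
      rw [mul_assoc, h'.right, mul_smul_comm, ← pow_succ]
    rw [mul_assoc _ B, e1, ← mul_assoc _ B', e2, mul_smul_comm, smul_mul_assoc, ← smul_add]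
    congr 1
    rw [pow_add r, pow_add ρ]
    noncomm_ring
  rw [e]
  refine (norm_add_le_of_le
    (norm_mul_le_of_le (norm_pow_sub_pow_mul_le hτ.ne' h h' hr hρ hB (a + 1)) (hr.diff_le b))
    (norm_mul_le_of_le (hρ.diff_le a) k2)).trans ?_
  push_cast
  have hq : 0 ≤ M ^ 3 * δ := by positivity
  have g1 : M ^ 3 * δ / (b + 1) ≤ 3 * (M ^ 3 * δ) / (a + 1 + (b + 1)) := by
    rw [div_le_div_iff₀ (by positivity) (by positivity)]
    have : (a + 1 + (b + 1) : ℝ) ≤ 3 * (b + 1) := by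
      have : (0 : ℝ) ≤ b := by positivity
      linarith
    calc _ ≤ M ^ 3 * δ * (3 * (b + 1)) := by gcongr
      _ = _ := by ring
  have g2 : M ^ 3 * δ / (a + 1) ≤ 3 * (M ^ 3 * δ) / (a + 1 + (b + 1)) := by
    rw [div_le_div_iff₀ (by positivity) (by positivity)]
    have : (a + 1 + (b + 1) : ℝ) ≤ 3 * (a + 1) := by
      have : (0 : ℝ) ≤ a := by positivity
      linarith
    calc _ ≤ M ^ 3 * δ * (3 * (a + 1)) := by gcongr
      _ = _ := by ring
  have g3 : 0 ≤ M ^ 2 * δ / (a + 1 + (b + 1)) := by positivity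
  calc _ = 4 * (M ^ 3 * δ / (b + 1)) + 6 * (M ^ 3 * δ / (a + 1)) := by ring
    _ ≤ 4 * (3 * (M ^ 3 * δ) / (a + 1 + (b + 1))) + 6 * (3 * (M ^ 3 * δ) / (a + 1 + (b + 1)))
        + 30 * (M ^ 2 * δ / (a + 1 + (b + 1))) := by linarith
    _ = _ := by ring

end ImplicitEuler

/-! ### Accretive operators and the smoothing of implicit Euler -/

section Accretive

variable {E : Type*} [NormedAddCommGroup E] [InnerProductSpace ℝ E]

/-- A bounded operator with `(L x, x) ≥ 0` for all `x`. -/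
def IsAccretive (L : E →L[ℝ] E) : Prop := ∀ x : E, 0 ≤ inner ℝ (L x) x

lemma isAccretive_of_add {A A₁ A₂ : E →L[ℝ] E} (hA : A = A₁ + A₂) (h₁ : IsAccretive A₁)
    (h₂ : IsAccretive A₂) : IsAccretive A := fun x => by
  rw [hA, add_apply, inner_add_left]; exact add_nonneg (h₁ x) (h₂ x)

/-- `(1 + s L)⁻¹`; for accretive `L` and `s ≥ 0` the inverse exists and is a contraction. -/
noncomputable def resolv (L : E →L[ℝ] E) (s : ℝ) : E →L[ℝ] E := Ring.inverse (1 + s • L)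

namespace IsAccretive

variable {L : E →L[ℝ] E} {s : ℝ}

lemma norm_le_norm_add (hL : IsAccretive L) (hs : 0 ≤ s) (x : E) : ‖x‖ ≤ ‖x + s • L x‖ := by
  rw [← sq_le_sq₀ (norm_nonneg _) (norm_nonneg _), norm_add_sq_real, real_inner_smul_right,
    real_inner_comm]
  have := mul_nonneg hs (hL x)
  nlinarith [sq_nonneg ‖s • L x‖]

lemma norm_smul_le_norm_add (hL : IsAccretive L) (hs : 0 ≤ s) (x : E) :
    ‖s • L x‖ ≤ ‖x + s • L x‖ := by
  rw [← sq_le_sq₀ (norm_nonneg _) (norm_nonneg _), norm_add_sq_real, real_inner_smul_right,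
    real_inner_comm]
  have := mul_nonneg hs (hL x)
  nlinarith [sq_nonneg ‖x‖]

lemma norm_sub_le_norm_add (hL : IsAccretive L) (hs : 0 ≤ s) (x : E) :
    ‖x - s • L x‖ ≤ ‖x + s • L x‖ := by
  rw [← sq_le_sq₀ (norm_nonneg _) (norm_nonneg _), norm_add_sq_real, norm_sub_sq_real,
    real_inner_smul_right, real_inner_comm]
  have := mul_nonneg hs (hL x)
  linarith

variable [CompleteSpace E]

lemma isUnit_one_add_smul (hL : IsAccretive L) (hs : 0 ≤ s) : IsUnit (1 + s • L) := by
  refine ContinuousLinearMap.isUnit_of_forall_le_norm_inner_map (𝕜 := ℝ) _ (c := 1) one_pos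
    fun x => ?_
  have : inner ℝ ((1 + s • L) x) x = ‖x‖ ^ 2 + s * inner ℝ (L x) x := by
    simp [inner_add_left, real_inner_smul_left]
  rw [this, Real.norm_of_nonneg (add_nonneg (sq_nonneg _) (mul_nonneg hs (hL x)))]
  simpa using mul_nonneg hs (hL x)

lemma add_mul_resolv (hL : IsAccretive L) (hs : 0 ≤ s) : (1 + s • L) * resolv L s = 1 :=
  Ring.mul_inverse_cancel _ (hL.isUnit_one_add_smul hs)

lemma resolv_mul_add (hL : IsAccretive L) (hs : 0 ≤ s) : resolv L s * (1 + s • L) = 1 :=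
  Ring.inverse_mul_cancel _ (hL.isUnit_one_add_smul hs)

lemma smul_mul_resolv (hL : IsAccretive L) (hs : 0 ≤ s) :
    (s • L) * resolv L s = 1 - resolv L s := by
  rw [eq_sub_iff_add_eq, add_comm]; simpa [add_mul] using hL.add_mul_resolv hs

lemma resolv_mul_smul (hL : IsAccretive L) (hs : 0 ≤ s) :
    resolv L s * (s • L) = 1 - resolv L s := by
  rw [eq_sub_iff_add_eq, add_comm]; simpa [mul_add] using hL.resolv_mul_add hs

lemma resolv_add_apply (hL : IsAccretive L) (hs : 0 ≤ s) (x : E) :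
    resolv L s x + s • L (resolv L s x) = x := by
  simpa using congr($(hL.add_mul_resolv hs) x)

lemma resolv_apply_add (hL : IsAccretive L) (hs : 0 ≤ s) (x : E) :
    resolv L s (x + s • L x) = x := by
  simpa using congr($(hL.resolv_mul_add hs) x)

lemma norm_resolv_le (hL : IsAccretive L) (hs : 0 ≤ s) : ‖resolv L s‖ ≤ 1 := by
  refine ContinuousLinearMap.opNorm_le_bound _ zero_le_one fun x => ?_
  simpa [hL.resolv_add_apply hs x] using hL.norm_le_norm_add hs (resolv L s x)

lemma norm_one_sub_resolv_le (hL : IsAccretive L) (hs : 0 ≤ s) : ‖1 - resolv L s‖ ≤ 1 := by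
  refine ContinuousLinearMap.opNorm_le_bound _ zero_le_one fun x => ?_
  rw [← hL.smul_mul_resolv hs]
  simpa [hL.resolv_add_apply hs x] using hL.norm_smul_le_norm_add hs (resolv L s x)

/-- The Cayley transform `(1 - s L) (1 + s L)⁻¹ = (1 + s L)⁻¹ - s L (1 + s L)⁻¹` is a
contraction. -/
lemma norm_cayley_le (hL : IsAccretive L) (hs : 0 ≤ s) :
    ‖resolv L s - (1 - resolv L s)‖ ≤ 1 := by
  refine ContinuousLinearMap.opNorm_le_bound _ zero_le_one fun x => ?_
  rw [← hL.smul_mul_resolv hs]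
  simpa [hL.resolv_add_apply hs x] using hL.norm_sub_le_norm_add hs (resolv L s x)

lemma resolv_pos (hL : IsAccretive L) (hs : 0 ≤ s) : IsAccretive (resolv L s) := by
  intro x
  have e := hL.resolv_add_apply hs x
  calc 0 ≤ inner ℝ (resolv L s x) (resolv L s x) + s * inner ℝ (L (resolv L s x)) (resolv L s x) :=
        add_nonneg real_inner_self_nonneg (mul_nonneg hs (hL _))
    _ = inner ℝ (resolv L s x) x := by
      rw [real_inner_comm _ (L (resolv L s x)), ← real_inner_smul_right, ← inner_add_right, e]

end IsAccretive

lemma isImplicitEuler_inverse_resolv [CompleteSpace E] {L : E →L[ℝ] E} {τ : ℝ}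
    (hL : IsAccretive L) (hu : IsUnit L) (hτ : 0 ≤ τ) :
    IsImplicitEuler τ (Ring.inverse L) (resolv L τ) := by
  constructor
  · rw [← hL.smul_mul_resolv hτ, smul_mul_assoc, mul_smul_comm, ← mul_assoc,
      Ring.inverse_mul_cancel _ hu, one_mul]
  · rw [← hL.resolv_mul_smul hτ, mul_smul_comm, smul_mul_assoc, mul_assoc,
      Ring.mul_inverse_cancel _ hu, mul_one]

lemma norm_pow_le_one {𝔸 : Type*} [SeminormedRing 𝔸] (h1 : ‖(1 : 𝔸)‖ ≤ 1) {a : 𝔸} (ha : ‖a‖ ≤ 1)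
    (n : ℕ) : ‖a ^ n‖ ≤ 1 := by
  induction n with
  | zero => simpa using h1
  | succ n ih => rw [pow_succ]; exact (norm_mul_le_of_le ih ha).trans (by norm_num)

/-- The number `‖pₖ‖² k² + (C/c)² ‖uₖ‖²` with `uₖ = rᵏ x` and `pₖ = τ L uₖ = uₖ₋₁ - uₖ`
(here `k = n + 1`) does not increase with `k`: it is a Lyapunov function for implicit Euler. -/
lemma lyapunov_implicitEuler {L r : E →L[ℝ] E} {N : E → ℝ} {c C τ : ℝ} (hc : 0 < c) (hC : 0 < C)
    (hτ : 0 ≤ τ) (hcoer : ∀ v, c * N v ^ 2 ≤ inner ℝ (L v) v)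
    (hbdd : ∀ v w, |inner ℝ (L v) w| ≤ C * N v * N w)
    (hr : ∀ x, r x + τ • L (r x) = x) (x : E) (n : ℕ) :
    (n + 1 : ℝ) ^ 2 * ‖(r ^ n) (x - r x)‖ ^ 2 + (C / c) ^ 2 * ‖(r ^ (n + 1)) x‖ ^ 2
      ≤ (1 + (C / c) ^ 2) * ‖x‖ ^ 2 := by
  have hpos : ∀ v, 0 ≤ inner ℝ (L v) v := fun v =>
    (mul_nonneg hc.le (sq_nonneg (N v))).trans (hcoer v)
  have hdec : ∀ v, ‖r v‖ ^ 2 + 2 * (τ * inner ℝ (L (r v)) (r v)) + ‖τ • L (r v)‖ ^ 2 = ‖v‖ ^ 2 := by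
    intro v
    conv_rhs => rw [← hr v]
    rw [norm_add_sq_real, real_inner_smul_right, real_inner_comm]
  have hsub : ∀ v, v - r v = τ • L (r v) := fun v => by
    rw [sub_eq_iff_eq_add, add_comm]; exact (hr v).symm
  induction n with
  | zero =>
    have h1 := hdec x
    rw [← hsub] at h1
    have h2 := mul_nonneg hτ (hpos (r x))
    have h3 : ‖r x‖ ^ 2 ≤ ‖x‖ ^ 2 := by nlinarith [sq_nonneg ‖x - r x‖]
    have h4 : ‖x - r x‖ ^ 2 ≤ ‖x‖ ^ 2 := by nlinarith [sq_nonneg ‖r x‖]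
    have h5 : (C / c) ^ 2 * ‖r x‖ ^ 2 ≤ (C / c) ^ 2 * ‖x‖ ^ 2 := by gcongr
    simp only [Nat.cast_zero, zero_add, one_pow, one_mul, pow_zero, pow_one,
      one_apply_eq_self]
    linarith
  | succ n ih =>
    refine le_trans ?_ ih
    have eu : (r ^ (n + 1 + 1)) x = r ((r ^ (n + 1)) x) := by rw [pow_succ' r (n + 1)]; rfl
    have ep : (r ^ (n + 1)) (x - r x) = r ((r ^ n) (x - r x)) := by rw [pow_succ' r n]; rfl
    have epu : (r ^ (n + 1)) (x - r x) = (r ^ (n + 1)) x - r ((r ^ (n + 1)) x) := by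
      rw [map_sub, ← eu, pow_succ r (n + 1)]; rfl
    rw [eu, ep]
    rw [ep] at epu
    generalize (r ^ (n + 1)) x = u at epu ⊢
    generalize (r ^ n) (x - r x) = p at epu ⊢
    have h1 := hdec u
    have h2 := hdec p
    have h3 : ‖r p‖ ^ 2 = τ * inner ℝ (L (r u)) (r p) := by
      rw [← real_inner_self_eq_norm_sq]
      nth_rw 1 [epu]
      rw [hsub, real_inner_smul_left]
    have h4 : inner ℝ (L (r u)) (r p) ≤ C * N (r u) * N (r p) := (le_abs_self _).trans (hbdd _ _)
    have h5 := hcoer (r u)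
    have h6 := hcoer (r p)
    set a := N (r u)
    set b := N (r p)
    set m : ℝ := (n : ℝ) + 1 with hm
    have hm1 : 1 ≤ m := by rw [hm]; have : (0 : ℝ) ≤ n := by positivity
                           linarith
    push_cast
    rw [← hm]
    have d1 : ‖r u‖ ^ 2 - ‖u‖ ^ 2 ≤ -(2 * τ * c * a ^ 2) := by
      have := mul_le_mul_of_nonneg_left h5 hτ
      nlinarith [sq_nonneg ‖τ • L (r u)‖]
    have d2 : ‖r p‖ ^ 2 - ‖p‖ ^ 2 ≤ -(2 * τ * c * b ^ 2) := by
      have := mul_le_mul_of_nonneg_left h6 hτ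
      nlinarith [sq_nonneg ‖τ • L (r p)‖]
    have d3 : ‖r p‖ ^ 2 ≤ τ * (C * a * b) := by
      rw [h3]; gcongr
    set q := C / c with hq
    have hCq : C = q * c := by rw [hq]; field_simp
    have hq0 : 0 < q := div_pos hC hc
    -- the quadratic form left over in `q a` and `m b` is nonnegative
    have key : (2 * m + 1) * (τ * (C * a * b))
        ≤ m ^ 2 * (2 * τ * c * b ^ 2) + q ^ 2 * (2 * τ * c * a ^ 2) := by
      have e1 : (2 * m + 1) * (τ * (C * a * b)) ≤ 3 * m * (τ * (C * |a * b|)) := by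
        have : a * b ≤ |a * b| := le_abs_self _
        have h0 : τ * (C * a * b) ≤ τ * (C * |a * b|) := by rw [mul_assoc C]; gcongr
        calc _ ≤ (2 * m + 1) * (τ * (C * |a * b|)) := by gcongr
          _ ≤ _ := by gcongr; linarith
      have e2 : 3 * m * (τ * (C * |a * b|)) = τ * c * (3 * ((q * |a|) * (m * |b|))) := by
        rw [hCq, abs_mul]; ring
      have e3 : m ^ 2 * (2 * τ * c * b ^ 2) + q ^ 2 * (2 * τ * c * a ^ 2)
          = τ * c * (2 * (q * |a|) ^ 2 + 2 * (m * |b|) ^ 2) := by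
        rw [mul_pow, mul_pow, sq_abs, sq_abs]; ring
      rw [e3]
      refine e1.trans (e2.trans_le ?_)
      gcongr
      nlinarith [sq_nonneg (q * |a| - m * |b|), sq_nonneg (q * |a|), sq_nonneg (m * |b|)]
    have f1 := mul_le_mul_of_nonneg_left d1 (sq_nonneg q)
    have f2 := mul_le_mul_of_nonneg_left d2 (sq_nonneg m)
    have f3 := mul_le_mul_of_nonneg_left d3 (by linarith : (0 : ℝ) ≤ 2 * m + 1)
    have f4 : (m + 1) ^ 2 * ‖r p‖ ^ 2 = m ^ 2 * ‖r p‖ ^ 2 + (2 * m + 1) * ‖r p‖ ^ 2 := by ring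
    rw [f4]
    rw [mul_sub] at f1 f2
    rw [mul_neg] at f1 f2
    linarith

/-- An operator that is coercive and bounded with respect to one and the same seminorm `N` has the
discrete smoothing property, with a constant that depends on these two bounds only. -/
lemma norm_pow_mul_one_sub_le {L r : E →L[ℝ] E} {N : E → ℝ} {c C τ : ℝ} (hc : 0 < c) (hC : 0 < C)
    (hτ : 0 ≤ τ) (hcoer : ∀ v, c * N v ^ 2 ≤ inner ℝ (L v) v)
    (hbdd : ∀ v w, |inner ℝ (L v) w| ≤ C * N v * N w)
    (hr : ∀ x, r x + τ • L (r x) = x) (n : ℕ) :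
    ‖r ^ n * (1 - r)‖ ≤ (1 + C / c) / (n + 1) := by
  have hq : 0 < C / c := div_pos hC hc
  refine ContinuousLinearMap.opNorm_le_bound _ (by positivity) fun x => ?_
  have h := lyapunov_implicitEuler hc hC hτ hcoer hbdd hr x n
  have h1 : ((n + 1 : ℝ) * ‖(r ^ n) (x - r x)‖) ^ 2 ≤ ((1 + C / c) * ‖x‖) ^ 2 := by
    rw [mul_pow, mul_pow]
    have : 0 ≤ (C / c) ^ 2 * ‖(r ^ (n + 1)) x‖ ^ 2 := by positivity
    have : (1 + (C / c) ^ 2) * ‖x‖ ^ 2 ≤ (1 + C / c) ^ 2 * ‖x‖ ^ 2 := by gcongr; nlinarith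
    linarith
  have h2 := (sq_le_sq₀ (by positivity) (by positivity)).1 h1
  have h3 : (r ^ n * (1 - r)) x = (r ^ n) (x - r x) := by simp
  rw [h3, div_mul_eq_mul_div, le_div_iff₀ (by positivity)]
  linarith

end Accretive

/-! ### The Douglas–Rachford scheme and implicit Euler -/

section DouglasRachford

variable {E : Type*} [NormedAddCommGroup E] [InnerProductSpace ℝ E] [CompleteSpace E]
  {A A₁ A₂ : E →L[ℝ] E} {τ : ℝ}

/-- One step of the Douglas–Rachford scheme. -/
noncomputable def drStep (A₁ A₂ : E →L[ℝ] E) (τ : ℝ) : E →L[ℝ] E :=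
  resolv A₂ τ * resolv A₁ τ * (1 + τ ^ 2 • (A₁ * A₂))

/-- The operator `½ (1 + C₁ C₂)`, with the Cayley transforms `C₁`, `C₂` of `τ A₁`, `τ A₂`, to which
the Douglas–Rachford step is conjugate. -/
noncomputable def drConj (A₁ A₂ : E →L[ℝ] E) (τ : ℝ) : E →L[ℝ] E :=
  resolv A₁ τ * resolv A₂ τ + (1 - resolv A₁ τ) * (1 - resolv A₂ τ)

lemma norm_drConj_le (h₁ : IsAccretive A₁) (h₂ : IsAccretive A₂) (hτ : 0 ≤ τ) :
    ‖drConj A₁ A₂ τ‖ ≤ 1 := by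
  have e : drConj A₁ A₂ τ = (1 / 2 : ℝ) • (1 + (resolv A₁ τ - (1 - resolv A₁ τ))
      * (resolv A₂ τ - (1 - resolv A₂ τ))) := by
    have : (2 : ℝ) • drConj A₁ A₂ τ = 1 + (resolv A₁ τ - (1 - resolv A₁ τ))
      * (resolv A₂ τ - (1 - resolv A₂ τ)) := by
      rw [two_smul, drConj]; noncomm_ring
    rw [← this, smul_smul]; norm_num
  rw [e, norm_smul]
  have h := norm_add_le_of_le (a₁ := (1 : E →L[ℝ] E)) ContinuousLinearMap.norm_id_le
    (norm_mul_le_of_le (h₁.norm_cayley_le hτ) (h₂.norm_cayley_le hτ))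
  rw [Real.norm_of_nonneg (by norm_num)]
  linarith

lemma drStep_mul_resolv (h₁ : IsAccretive A₁) (h₂ : IsAccretive A₂) (hτ : 0 ≤ τ) :
    drStep A₁ A₂ τ * resolv A₂ τ = resolv A₂ τ * drConj A₁ A₂ τ := by
  have e1 : resolv A₁ τ * (τ ^ 2 • (A₁ * A₂)) * resolv A₂ τ
      = (1 - resolv A₁ τ) * (1 - resolv A₂ τ) := by
    rw [← h₁.resolv_mul_smul hτ, ← h₂.smul_mul_resolv hτ, pow_two, mul_smul]
    simp only [smul_mul_assoc, mul_smul_comm, mul_assoc]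
  rw [drStep, drConj, ← e1]
  noncomm_ring

lemma drStep_pow_mul_resolv (h₁ : IsAccretive A₁) (h₂ : IsAccretive A₂) (hτ : 0 ≤ τ) (m : ℕ) :
    drStep A₁ A₂ τ ^ m * resolv A₂ τ = resolv A₂ τ * drConj A₁ A₂ τ ^ m := by
  induction m with
  | zero => simp
  | succ m ih =>
    rw [pow_succ, mul_assoc, drStep_mul_resolv h₁ h₂ hτ, ← mul_assoc, ih, mul_assoc, ← pow_succ]

lemma norm_drStep_pow_mul_le (h₁ : IsAccretive A₁) (h₂ : IsAccretive A₂) (hτ : 0 ≤ τ) (m : ℕ) :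
    ‖drStep A₁ A₂ τ ^ m * resolv A₂ τ‖ ≤ 1 := by
  rw [drStep_pow_mul_resolv h₁ h₂ hτ]
  exact (norm_mul_le_of_le (h₂.norm_resolv_le hτ)
    (norm_pow_le_one ContinuousLinearMap.norm_id_le (norm_drConj_le h₁ h₂ hτ) m)).trans
    (by norm_num)

lemma norm_drStep_pow_mul_resolv_le (h₁ : IsAccretive A₁) (h₂ : IsAccretive A₂) (hτ : 0 ≤ τ)
    (m : ℕ) : ‖drStep A₁ A₂ τ ^ m * resolv A₂ τ * resolv A₁ τ‖ ≤ 1 :=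
  (norm_mul_le_of_le (norm_drStep_pow_mul_le h₁ h₂ hτ m) (h₁.norm_resolv_le hτ)).trans (by norm_num)

/-- `(1 + τ A₁) (1 + τ A₂) (1 + τ A)⁻¹ = 1 + τ² A₁ A₂ (1 + τ A)⁻¹`, solved for the defect of the
factorized resolvent. -/
lemma resolv_mul_resolv_sub (hA : A = A₁ + A₂) (h₁ : IsAccretive A₁) (h₂ : IsAccretive A₂)
    (hτ : 0 ≤ τ) : resolv A₂ τ * resolv A₁ τ - resolv A τ
      = -(resolv A₂ τ * resolv A₁ τ * (τ ^ 2 • (A₁ * A₂)) * resolv A τ) := by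
  have hacc := isAccretive_of_add hA h₁ h₂
  have e : resolv A₂ τ * resolv A₁ τ * ((1 + τ • A₁) * (1 + τ • A₂)) = 1 := by
    calc _ = resolv A₂ τ * (resolv A₁ τ * (1 + τ • A₁)) * (1 + τ • A₂) := by noncomm_ring
      _ = 1 := by rw [h₁.resolv_mul_add hτ, mul_one, h₂.resolv_mul_add hτ]
  have e' : (1 + τ • A₁) * (1 + τ • A₂) = (1 + τ • A) + τ ^ 2 • (A₁ * A₂) := by
    rw [hA, pow_two, mul_smul]
    simp only [add_mul, mul_add, one_mul, mul_one, smul_mul_assoc, mul_smul_comm, smul_add]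
    abel
  have e2 : resolv A τ = resolv A₂ τ * resolv A₁ τ * (1 + τ ^ 2 • (A₁ * A₂) * resolv A τ) := by
    calc resolv A τ = resolv A₂ τ * resolv A₁ τ * ((1 + τ • A₁) * (1 + τ • A₂)) * resolv A τ := by
          rw [e, one_mul]
      _ = resolv A₂ τ * resolv A₁ τ * ((1 + τ • A) * resolv A τ
          + τ ^ 2 • (A₁ * A₂) * resolv A τ) := by rw [e', mul_assoc, add_mul]
      _ = _ := by rw [hacc.add_mul_resolv hτ]
  nth_rw 1 [e2]
  noncomm_ring

lemma drStep_sub_resolv (hA : A = A₁ + A₂) (h₁ : IsAccretive A₁) (h₂ : IsAccretive A₂)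
    (hτ : 0 ≤ τ) : drStep A₁ A₂ τ - resolv A τ
      = resolv A₂ τ * resolv A₁ τ * (τ ^ 2 • (A₁ * A₂)) * (1 - resolv A τ) := by
  have h := resolv_mul_resolv_sub hA h₁ h₂ hτ
  have e : drStep A₁ A₂ τ = resolv A₂ τ * resolv A₁ τ
      + resolv A₂ τ * resolv A₁ τ * (τ ^ 2 • (A₁ * A₂)) := by rw [drStep, mul_add, mul_one]
  calc _ = (resolv A₂ τ * resolv A₁ τ - resolv A τ)
        + resolv A₂ τ * resolv A₁ τ * (τ ^ 2 • (A₁ * A₂)) := by rw [e]; abel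
    _ = _ := by rw [h]; noncomm_ring

variable {Q : E →L[ℝ] E} {K M : ℝ}

/-- In the local errors the factor `τ² A₁ A₂` meets smooth data: `τ A₁` is absorbed by the scheme,
and `τ A₂ Q` is of size `τ` for `Q = A⁻¹`. -/
lemma norm_drStep_pow_mul_local_le (h₁ : IsAccretive A₁) (h₂ : IsAccretive A₂)
    (hτ : 0 ≤ τ) (hK : ‖A₂ * Q‖ ≤ K) (m : ℕ) {X : E →L[ℝ] E} {x : ℝ} (hX : ‖X‖ ≤ x) :
    ‖drStep A₁ A₂ τ ^ m * (resolv A₂ τ * resolv A₁ τ * (τ ^ 2 • (A₁ * A₂)) * (Q * X))‖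
      ≤ τ * K * x := by
  have e : drStep A₁ A₂ τ ^ m * (resolv A₂ τ * resolv A₁ τ * (τ ^ 2 • (A₁ * A₂)) * (Q * X))
      = (drStep A₁ A₂ τ ^ m * resolv A₂ τ) * (1 - resolv A₁ τ) * (τ • ((A₂ * Q) * X)) := by
    rw [← h₁.resolv_mul_smul hτ, pow_two, mul_smul]
    simp only [smul_mul_assoc, mul_smul_comm, mul_assoc]
  rw [e]
  have h3 : ‖τ • ((A₂ * Q) * X)‖ ≤ τ * (K * x) := by
    rw [norm_smul, Real.norm_of_nonneg hτ]
    gcongr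
    exact norm_mul_le_of_le hK hX
  exact (norm_mul₃_le_of_le (norm_drStep_pow_mul_le h₁ h₂ hτ m) (h₁.norm_one_sub_resolv_le hτ)
    h3).trans (by linarith)

lemma norm_drStep_pow_sub_mul_le (hA : A = A₁ + A₂) (h₁ : IsAccretive A₁) (h₂ : IsAccretive A₂)
    (hτ : 0 ≤ τ) (hQ : Commute Q (resolv A τ)) (hK : ‖A₂ * Q‖ ≤ K)
    (hM : ∀ j : ℕ, ‖resolv A τ ^ j * (1 - resolv A τ)‖ ≤ M / (j + 1)) (m : ℕ) :
    ∀ k : ℕ, ‖(drStep A₁ A₂ τ ^ m - resolv A τ ^ m) * resolv A τ ^ k * Q‖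
      ≤ τ * K * M * ∑ i ∈ Finset.range m, (((k + i : ℕ) : ℝ) + 1)⁻¹ := by
  induction m with
  | zero => simp
  | succ m ih =>
    intro k
    set r := resolv A τ
    have e1 : (1 - r) * r ^ k * Q = Q * (r ^ k * (1 - r)) := by
      have c1 : Commute (1 - r) (r ^ k) :=
        ((Commute.one_left _).sub_left (Commute.refl r)).pow_right k
      have c2 : Commute Q (r ^ k * (1 - r)) :=
        (hQ.pow_right k).mul_right ((Commute.one_right _).sub_right hQ)
      rw [c1.eq, c2.eq]
    have e : (drStep A₁ A₂ τ ^ (m + 1) - r ^ (m + 1)) * r ^ k * Q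
        = drStep A₁ A₂ τ ^ m * (resolv A₂ τ * resolv A₁ τ * (τ ^ 2 • (A₁ * A₂))
            * (Q * (r ^ k * (1 - r))))
          + (drStep A₁ A₂ τ ^ m - r ^ m) * r ^ (k + 1) * Q := by
      rw [← e1]
      calc _ = drStep A₁ A₂ τ ^ m * (drStep A₁ A₂ τ - r) * r ^ k * Q
            + (drStep A₁ A₂ τ ^ m - r ^ m) * r ^ (k + 1) * Q := by
            rw [pow_succ (drStep A₁ A₂ τ) m, pow_succ r m, pow_succ' r k]; noncomm_ring
        _ = _ := by rw [drStep_sub_resolv hA h₁ h₂ hτ]; simp only [mul_assoc]; rfl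
    rw [e, Finset.sum_range_succ']
    refine (norm_add_le_of_le (norm_drStep_pow_mul_local_le h₁ h₂ hτ hK m (hM k))
      (ih (k + 1))).trans (le_of_eq ?_)
    have e2 : ∀ i, k + 1 + i = k + (i + 1) := fun i => by omega
    simp only [e2, add_zero]
    ring

/-- The difference of the Douglas–Rachford scheme and implicit Euler, for smooth data. -/
lemma norm_drStep_pow_mul_sub_mul_le (hA : A = A₁ + A₂) (h₁ : IsAccretive A₁)
    (h₂ : IsAccretive A₂) (hτ : 0 ≤ τ) (hQ : Commute Q (resolv A τ)) (hK : ‖A₂ * Q‖ ≤ K)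
    (hM1 : 1 ≤ M) (hM : ∀ j : ℕ, ‖resolv A τ ^ j * (1 - resolv A τ)‖ ≤ M / (j + 1)) {n : ℕ}
    (hn : 1 ≤ n) :
    ‖(drStep A₁ A₂ τ ^ (n - 1) * resolv A₂ τ * resolv A₁ τ - resolv A τ ^ n) * Q‖
      ≤ 2 * K * M * ((1 + Real.log n) * τ) := by
  have hK0 : 0 ≤ K := (norm_nonneg _).trans hK
  have hacc := isAccretive_of_add hA h₁ h₂
  obtain ⟨m, rfl⟩ : ∃ m, n = m + 1 := ⟨n - 1, by omega⟩
  rw [Nat.add_sub_cancel]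
  have e : (drStep A₁ A₂ τ ^ m * resolv A₂ τ * resolv A₁ τ - resolv A τ ^ (m + 1)) * Q
      = (drStep A₁ A₂ τ ^ m - resolv A τ ^ m) * resolv A τ ^ 1 * Q
        - drStep A₁ A₂ τ ^ m * (resolv A₂ τ * resolv A₁ τ * (τ ^ 2 • (A₁ * A₂))
            * (Q * resolv A τ)) := by
    rw [hQ.eq]
    calc _ = (drStep A₁ A₂ τ ^ m - resolv A τ ^ m) * resolv A τ * Q
          + drStep A₁ A₂ τ ^ m * (resolv A₂ τ * resolv A₁ τ - resolv A τ) * Q := by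
          rw [pow_succ]; noncomm_ring
      _ = _ := by rw [resolv_mul_resolv_sub hA h₁ h₂ hτ, pow_one]; noncomm_ring
  rw [e]
  refine (norm_sub_le_of_le (norm_drStep_pow_sub_mul_le hA h₁ h₂ hτ hQ hK hM m 1)
    (norm_drStep_pow_mul_local_le h₁ h₂ hτ hK m (hacc.norm_resolv_le hτ))).trans ?_
  have hs : ∑ i ∈ Finset.range m, (((1 + i : ℕ) : ℝ) + 1)⁻¹ ≤ Real.log (m + 1 : ℕ) := by
    have h := harmonic_le_one_add_log (m + 1)
    rw [harmonic, Finset.sum_range_succ'] at h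
    push_cast at h ⊢
    have e3 : ∀ i : ℕ, (1 + (i : ℝ) + 1) = (i : ℝ) + 1 + 1 := fun i => by ring
    simp only [e3]
    norm_num at h ⊢
    linarith
  have hlog : 0 ≤ Real.log (m + 1 : ℕ) := Real.log_natCast_nonneg _
  calc _ ≤ τ * K * M * Real.log (m + 1 : ℕ) + τ * K * M := by gcongr
    _ = K * M * ((1 + Real.log (m + 1 : ℕ)) * τ) := by ring
    _ ≤ 2 * (K * M * ((1 + Real.log (m + 1 : ℕ)) * τ)) := by
      have : 0 ≤ K * M * ((1 + Real.log (m + 1 : ℕ)) * τ) := by positivity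
      linarith
    _ = _ := by ring

end DouglasRachford

/-! ### Contraction semigroups and implicit Euler -/

section Semigroup

variable {H : Type*} [NormedAddCommGroup H] [InnerProductSpace ℝ H]

/-- The infinitesimal generator of `T` is `-B⁻¹`, for a bounded operator `B`. -/
def GeneratesNegInverse (T : ℝ → H →L[ℝ] H) (B : H →L[ℝ] H) : Prop :=
  ∀ x y : H, B y = -x ↔ Tendsto (fun t : ℝ => t⁻¹ • (T t x - x)) (𝓝[>] 0) (𝓝 y)

/-- A nonincreasing norm, from the sign of the inner product with the right derivative. -/
lemma norm_le_of_inner_deriv_right_nonpos {u u' : ℝ → H} {b : ℝ} (hb : 0 ≤ b)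
    (hc : ContinuousOn u (Set.Icc 0 b))
    (hd : ∀ t ∈ Set.Ico 0 b, HasDerivWithinAt u (u' t) (Set.Ici t) t)
    (hneg : ∀ t ∈ Set.Ico 0 b, inner ℝ (u t) (u' t) ≤ 0) : ‖u b‖ ≤ ‖u 0‖ := by
  have h := image_le_of_deriv_right_le_deriv_boundary (f := fun t => ‖u t‖ ^ 2)
    (f' := fun t => 2 * inner ℝ (u t) (u' t)) (a := 0) (b := b) (hc.norm.pow 2)
    (fun t ht => (hd t ht).norm_sq) (B := fun _ => ‖u 0‖ ^ 2) (B' := fun _ => 0) le_rfl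
    continuousOn_const (fun t _ => hasDerivWithinAt_const _ _ _)
    (fun t ht => by have := hneg t ht; linarith) (Set.right_mem_Icc.2 hb)
  exact (sq_le_sq₀ (norm_nonneg _) (norm_nonneg _)).1 h

namespace IsC0Semigroup

variable {T : ℝ → H →L[ℝ] H} {B : H →L[ℝ] H}

lemma comp_comm (hT : IsC0Semigroup T) {s t : ℝ} (hs : 0 ≤ s) (ht : 0 ≤ t) (x : H) :
    T s (T t x) = T t (T s x) := by
  have h1 := congr($(hT.add s t hs ht) x)
  have h2 := congr($(hT.add t s ht hs) x)
  rw [add_comm t s] at h2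
  exact h1.symm.trans h2

lemma tendsto_zero (hT : IsC0Semigroup T) (x : H) :
    Tendsto (fun t => T t x) (𝓝[≥] 0) (𝓝 x) := by
  rw [← Set.Ioi_insert, nhdsWithin_insert]
  refine Tendsto.sup ?_ (hT.cont x)
  rw [tendsto_pure_left]
  intro s hs
  simpa [hT.zero] using mem_of_mem_nhds hs

lemma exists_norm_le_near_zero [CompleteSpace H] (hT : IsC0Semigroup T) :
    ∃ δ : ℝ, 0 < δ ∧ ∃ M : ℝ, 0 ≤ M ∧ ∀ t ∈ Set.Icc 0 δ, ‖T t‖ ≤ M := by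
  by_contra! hcon
  have hch : ∀ n : ℕ, ∃ t ∈ Set.Icc (0 : ℝ) (1 / (n + 1)), (n : ℝ) < ‖T t‖ := fun n =>
    hcon (1 / (n + 1)) (by positivity) n (by positivity)
  choose t ht hn using hch
  have ht0 : Tendsto t atTop (𝓝[≥] 0) :=
    tendsto_nhdsWithin_iff.2 ⟨squeeze_zero (fun n => (ht n).1) (fun n => (ht n).2)
      tendsto_one_div_add_atTop_nhds_zero_nat, Eventually.of_forall fun n => (ht n).1⟩
  obtain ⟨C, hC⟩ := banach_steinhaus (g := fun n => T (t n)) fun x => by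
    obtain ⟨C, hC⟩ := ((hT.tendsto_zero x).comp ht0).norm.bddAbove_range
    exact ⟨C, fun n => hC ⟨n, rfl⟩⟩
  obtain ⟨n, hn'⟩ := exists_nat_gt C
  exact absurd (hC n) (not_le.2 (hn'.trans (hn n)))

lemma exists_norm_le [CompleteSpace H] (hT : IsC0Semigroup T) (b : ℝ) :
    ∃ M : ℝ, 0 ≤ M ∧ ∀ t ∈ Set.Icc 0 b, ‖T t‖ ≤ M := by
  obtain ⟨δ, hδ, M, hM0, hM⟩ := hT.exists_norm_le_near_zero
  have key : ∀ k : ℕ, ∃ M : ℝ, 0 ≤ M ∧ ∀ t ∈ Set.Icc 0 (k * δ), ‖T t‖ ≤ M := by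
    intro k
    induction k with
    | zero =>
      exact ⟨M, hM0, fun t ht => hM t ⟨ht.1, ht.2.trans (by simpa using hδ.le)⟩⟩
    | succ k ih =>
      obtain ⟨K, hK0, hK⟩ := ih
      refine ⟨max M (M * K), hM0.trans (le_max_left _ _), fun t ht => ?_⟩
      rcases le_total t δ with h | h
      · exact (hM t ⟨ht.1, h⟩).trans (le_max_left _ _)
      · have e : T t = T δ ∘L T (t - δ) := by
          rw [← hT.add δ (t - δ) hδ.le (by linarith)]; congr 1; ring
        have h2 := ht.2
        push_cast at h2
        rw [e]
        exact ((ContinuousLinearMap.opNorm_comp_le _ _).trans (mul_le_mul (hM δ ⟨hδ.le, le_rfl⟩)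
          (hK _ ⟨by linarith, by linarith⟩) (norm_nonneg _) hM0)).trans (le_max_right _ _)
  obtain ⟨k, hk⟩ := exists_nat_gt (b / δ)
  obtain ⟨K, hK0, hK⟩ := key k
  exact ⟨K, hK0, fun t ht => hK t ⟨ht.1, ht.2.trans ((div_lt_iff₀ hδ).1 hk).le⟩⟩

lemma continuousOn [CompleteSpace H] (hT : IsC0Semigroup T) (x : H) :
    ContinuousOn (fun t => T t x) (Set.Ici 0) := by
  intro t₀ ht₀
  obtain ⟨M, hM0, hM⟩ := hT.exists_norm_le (t₀ + 1)
  have key : ∀ s ∈ Set.Icc 0 (t₀ + 1), ∀ t ∈ Set.Icc 0 (t₀ + 1), s ≤ t →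
      ‖T t x - T s x‖ ≤ M * ‖T |t - s| x - x‖ := by
    intro s hs t ht hst
    have e : T t x - T s x = T s (T |t - s| x - x) := by
      rw [map_sub, abs_of_nonneg (sub_nonneg.2 hst)]
      have := congr($(hT.add s (t - s) hs.1 (sub_nonneg.2 hst)) x)
      rw [add_sub_cancel] at this
      rw [this]; rfl
    rw [e]
    exact (T s).le_of_opNorm_le (hM s hs) _
  have hlim : Tendsto (fun t => M * ‖T |t - t₀| x - x‖) (𝓝[Set.Ici 0] t₀) (𝓝 0) := by
    have h1 : Tendsto (fun t : ℝ => |t - t₀|) (𝓝[Set.Ici 0] t₀) (𝓝[≥] 0) := by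
      refine tendsto_nhdsWithin_iff.2 ⟨?_,
        Eventually.of_forall fun t => Set.mem_Ici.2 (abs_nonneg _)⟩
      have : Tendsto (fun t : ℝ => |t - t₀|) (𝓝 t₀) (𝓝 |t₀ - t₀|) :=
        (by fun_prop : Continuous fun t : ℝ => |t - t₀|).tendsto t₀
      rw [sub_self, abs_zero] at this
      exact this.mono_left inf_le_left
    have h2 := (((hT.tendsto_zero x).comp h1).sub_const x).norm.const_mul M
    simpa using h2
  rw [ContinuousWithinAt, tendsto_iff_norm_sub_tendsto_zero]
  refine squeeze_zero' (Eventually.of_forall fun _ => norm_nonneg _) ?_ hlim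
  have hnear : ∀ᶠ t in 𝓝[Set.Ici 0] t₀, t ≤ t₀ + 1 :=
    mem_nhdsWithin_of_mem_nhds (Iic_mem_nhds (by linarith))
  filter_upwards [hnear, self_mem_nhdsWithin] with t ht1 ht0
  have ht₀' : t₀ ∈ Set.Icc 0 (t₀ + 1) := ⟨ht₀, by linarith⟩
  rcases le_total t₀ t with h | h
  · exact key t₀ ht₀' t ⟨ht0, ht1⟩ h
  · rw [norm_sub_rev, abs_sub_comm]
    exact key t ⟨ht0, ht1⟩ t₀ ht₀' h

lemma tendsto_slope (hG : GeneratesNegInverse T B) (y : H) :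
    Tendsto (fun t : ℝ => t⁻¹ • (T t (B y) - B y)) (𝓝[>] 0) (𝓝 (-y)) :=
  (hG (B y) (-y)).1 (map_neg _ _)

lemma tendsto_slope_apply (hT : IsC0Semigroup T) (hG : GeneratesNegInverse T B) {t : ℝ}
    (ht : 0 ≤ t) (y : H) :
    Tendsto (fun s : ℝ => s⁻¹ • (T s (T t (B y)) - T t (B y))) (𝓝[>] 0) (𝓝 (-(T t y))) := by
  have h := ((T t).continuous.tendsto _).comp (tendsto_slope hG y)
  rw [map_neg] at h
  refine h.congr' ?_
  filter_upwards [self_mem_nhdsWithin] with s hs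
  rw [hT.comp_comm (le_of_lt hs) ht]
  simp

lemma apply_comm (hT : IsC0Semigroup T) (hG : GeneratesNegInverse T B) {t : ℝ}
    (ht : 0 ≤ t) (y : H) : B (T t y) = T t (B y) := by
  have := (hG _ _).2 (hT.tendsto_slope_apply hG ht y)
  simpa using this

lemma hasDerivWithinAt (hT : IsC0Semigroup T) (hG : GeneratesNegInverse T B) {t : ℝ}
    (ht : 0 ≤ t) (y : H) :
    HasDerivWithinAt (fun t => T t (B y)) (-(T t y)) (Set.Ici t) t := by
  rw [← hasDerivWithinAt_Ioi_iff_Ici, hasDerivWithinAt_iff_tendsto_slope' (by simp)]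
  have h1 : Tendsto (fun s : ℝ => s - t) (𝓝[>] t) (𝓝[>] 0) := by
    refine tendsto_nhdsWithin_iff.2 ⟨?_, ?_⟩
    · have : Tendsto (fun s : ℝ => s - t) (𝓝 t) (𝓝 (t - t)) :=
        (by fun_prop : Continuous fun s : ℝ => s - t).tendsto t
      rw [sub_self] at this
      exact this.mono_left inf_le_left
    · filter_upwards [self_mem_nhdsWithin] with s hs using sub_pos.2 (Set.mem_Ioi.1 hs)
  refine ((hT.tendsto_slope_apply hG ht y).comp h1).congr' ?_
  filter_upwards [self_mem_nhdsWithin] with s hs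
  have := congr($(hT.add (s - t) t (sub_nonneg.2 (le_of_lt hs)) ht) (B y))
  rw [sub_add_cancel] at this
  rw [slope_def_module, this]
  rfl

lemma apply_nat_mul (hT : IsC0Semigroup T) {τ : ℝ} (hτ : 0 ≤ τ) (n : ℕ) :
    T (n * τ) = T τ ^ n := by
  induction n with
  | zero => simp [hT.zero]
  | succ n ih =>
    rw [pow_succ, ← ih]
    have := hT.add (n * τ) τ (by positivity) hτ
    rw [show ((n + 1 : ℕ) : ℝ) * τ = n * τ + τ by push_cast; ring, this]
    rfl

variable [CompleteSpace H]

/-- The semigroup generated by `-B⁻¹` is contractive for accretive `B` with dense range. -/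
lemma norm_apply_le (hT : IsC0Semigroup T) (hG : GeneratesNegInverse T B) (hB : IsAccretive B)
    (hd : DenseRange B) {t : ℝ} (ht : 0 ≤ t) (x : H) : ‖T t x‖ ≤ ‖x‖ := by
  refine hd.induction_on x (isClosed_le (by fun_prop) (by fun_prop)) fun y => ?_
  have h := norm_le_of_inner_deriv_right_nonpos (u := fun s => T s (B y))
    (u' := fun s => -(T s y)) ht ((hT.continuousOn _).mono Set.Icc_subset_Ici_self)
    (fun s hs => hT.hasDerivWithinAt hG hs.1 y) fun s hs => by
      rw [← hT.apply_comm hG hs.1, inner_neg_right]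
      have := hB (T s y)
      linarith
  simpa [hT.zero] using h

lemma norm_le_one (hT : IsC0Semigroup T) (hG : GeneratesNegInverse T B) (hB : IsAccretive B)
    (hd : DenseRange B) {t : ℝ} (ht : 0 ≤ t) : ‖T t‖ ≤ 1 :=
  ContinuousLinearMap.opNorm_le_bound _ zero_le_one fun x => by
    simpa using hT.norm_apply_le hG hB hd ht x

lemma norm_apply_sub_le (hT : IsC0Semigroup T) (hG : GeneratesNegInverse T B) (hB : IsAccretive B)
    (hd : DenseRange B) {t : ℝ} (ht : 0 ≤ t) (y : H) : ‖T t (B y) - B y‖ ≤ t * ‖y‖ := by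
  have h := norm_image_sub_le_of_norm_deriv_right_le_segment (f := fun s => T s (B y))
    (f' := fun s => -(T s y)) (C := ‖y‖) ((hT.continuousOn _).mono Set.Icc_subset_Ici_self)
    (fun s hs => hT.hasDerivWithinAt hG hs.1 y)
    (fun s hs => by rw [norm_neg]; exact hT.norm_apply_le hG hB hd hs.1 y) t
    (Set.right_mem_Icc.2 ht)
  simpa [hT.zero, mul_comm] using h

lemma norm_apply_sub_add_le (hT : IsC0Semigroup T) (hG : GeneratesNegInverse T B)
    (hB : IsAccretive B) (hd : DenseRange B) {t : ℝ} (ht : 0 ≤ t) (z : H) :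
    ‖T t (B (B z)) - B (B z) + t • B z‖ ≤ t ^ 2 * ‖z‖ := by
  have h := norm_image_sub_le_of_norm_deriv_right_le_segment
    (f := fun s => T s (B (B z)) + s • B z) (f' := fun s => -(T s (B z)) + (1 : ℝ) • B z)
    (C := t * ‖z‖) (a := 0) (b := t)
    (((hT.continuousOn _).mono Set.Icc_subset_Ici_self).add (by fun_prop))
    (fun s hs => (hT.hasDerivWithinAt hG hs.1 (B z)).add
      ((hasDerivWithinAt_id _ _).smul_const (B z)))
    (fun s hs => by
      rw [one_smul, neg_add_eq_sub, norm_sub_rev]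
      refine (hT.norm_apply_sub_le hG hB hd hs.1 z).trans ?_
      have := hs.2.le
      gcongr) t
    (Set.right_mem_Icc.2 ht)
  have e : T t (B (B z)) - B (B z) + t • B z
      = T t (B (B z)) + t • B z - (T 0 (B (B z)) + (0 : ℝ) • B z) := by
    rw [hT.zero]; simp; abel
  rw [e]
  refine h.trans (le_of_eq ?_)
  ring

variable {r : H →L[ℝ] H} {τ M : ℝ}

/-- Implicit Euler is consistent of order one. -/
lemma norm_sub_mul_mul_le (hT : IsC0Semigroup T) (hG : GeneratesNegInverse T B)
    (hB : IsAccretive B) (hd : DenseRange B) (hτ : 0 < τ) (hr : IsImplicitEuler τ B r)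
    (hr1 : ‖r‖ ≤ 1) : ‖(T τ - r) * (B * B)‖ ≤ 2 * τ ^ 2 := by
  have e : (T τ - r) * (B * B) = (T τ * (B * B) - B * B + τ • B) - τ ^ 2 • r := by
    have e1 : r * B = B - τ • r := by rw [← hr.right]; noncomm_ring
    have e2 : r * (B * B) = B * B - τ • B + τ ^ 2 • r := by
      rw [← mul_assoc, e1, sub_mul, smul_mul_assoc, e1, smul_sub, smul_smul, pow_two]; abel
    rw [sub_mul, e2]; abel
  rw [e]
  have h1 : ‖T τ * (B * B) - B * B + τ • B‖ ≤ τ ^ 2 :=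
    ContinuousLinearMap.opNorm_le_bound _ (by positivity) fun z =>
      hT.norm_apply_sub_add_le hG hB hd hτ.le z
  have h2 : ‖τ ^ 2 • r‖ ≤ τ ^ 2 := by
    rw [norm_smul, Real.norm_of_nonneg (by positivity)]
    exact mul_le_of_le_one_right (by positivity) hr1
  exact (norm_sub_le_of_le h1 h2).trans (by linarith)

lemma norm_sub_mul_le (hT : IsC0Semigroup T) (hG : GeneratesNegInverse T B)
    (hB : IsAccretive B) (hd : DenseRange B) (hτ : 0 < τ) (hr : IsImplicitEuler τ B r)
    (hr1 : ‖r‖ ≤ 1) : ‖(T τ - r) * B‖ ≤ 2 * τ := by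
  have e : (T τ - r) * B = (T τ * B - B) + τ • r := by
    rw [← hr.right]; noncomm_ring
  rw [e]
  have h1 : ‖T τ * B - B‖ ≤ τ :=
    ContinuousLinearMap.opNorm_le_bound _ hτ.le fun z => hT.norm_apply_sub_le hG hB hd hτ.le z
  have h2 : ‖τ • r‖ ≤ τ := by
    rw [norm_smul, Real.norm_of_nonneg hτ.le]
    exact mul_le_of_le_one_right hτ.le hr1
  exact (norm_add_le_of_le h1 h2).trans (by linarith)

lemma norm_sub_mul_pow_mul_le (hT : IsC0Semigroup T) (hG : GeneratesNegInverse T B)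
    (hB : IsAccretive B) (hd : DenseRange B) (hτ : 0 < τ) (hr : IsImplicitEuler τ B r)
    (hr1 : ‖r‖ ≤ 1) (hM : IsSmoothing M r) (k : ℕ) :
    ‖(T τ - r) * r ^ (k + 1) * B‖ ≤ 2 * τ * M * ((k : ℝ) + 1)⁻¹ := by
  have e : τ • ((T τ - r) * r ^ (k + 1) * B) = ((T τ - r) * (B * B)) * (r ^ k * (1 - r)) := by
    have c : (r ^ k * (1 - r)) * B = B * (r ^ k * (1 - r)) :=
      (((hr.comm.pow_right k).mul_right
        ((Commute.one_right _).sub_right hr.comm)).eq).symm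
    have : (B * B) * (r ^ k * (1 - r)) = τ • (r ^ (k + 1) * B) := by
      rw [mul_assoc, ← c, ← mul_assoc, ← mul_assoc, (hr.comm.pow_right k).eq, mul_assoc (r ^ k) B,
        hr.left, mul_smul_comm, ← pow_succ, smul_mul_assoc]
    rw [mul_assoc _ (B * B), this, mul_smul_comm, mul_assoc]
  have h := norm_mul_le_of_le (hT.norm_sub_mul_mul_le hG hB hd hτ hr hr1) (hM.diff_le k)
  rw [← e, norm_smul, Real.norm_of_nonneg hτ.le] at h
  refine le_of_mul_le_mul_left (h.trans (le_of_eq ?_)) hτ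
  rw [div_eq_mul_inv]; ring

lemma norm_pow_sub_pow_mul_pow_mul_le (hT : IsC0Semigroup T) (hG : GeneratesNegInverse T B)
    (hB : IsAccretive B) (hd : DenseRange B) (hτ : 0 < τ) (hr : IsImplicitEuler τ B r)
    (hr1 : ‖r‖ ≤ 1) (hM : IsSmoothing M r) (m : ℕ) : ∀ k : ℕ,
    ‖(T τ ^ m - r ^ m) * r ^ (k + 1) * B‖
      ≤ 2 * τ * M * ∑ i ∈ Finset.range m, (((k + i : ℕ) : ℝ) + 1)⁻¹ := by
  induction m with
  | zero => simp
  | succ m ih =>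
    intro k
    have e : (T τ ^ (m + 1) - r ^ (m + 1)) * r ^ (k + 1) * B
        = T τ ^ m * ((T τ - r) * r ^ (k + 1) * B) + (T τ ^ m - r ^ m) * r ^ (k + 1 + 1) * B := by
      rw [pow_succ (T τ) m, pow_succ r m, pow_succ' r (k + 1)]; noncomm_ring
    rw [e, Finset.sum_range_succ']
    have h1 : ‖T τ ^ m‖ ≤ 1 := norm_pow_le_one ContinuousLinearMap.norm_id_le
      (hT.norm_le_one hG hB hd hτ.le) m
    refine (norm_add_le_of_le (norm_mul_le_of_le h1
      (hT.norm_sub_mul_pow_mul_le hG hB hd hτ hr hr1 hM k)) (ih (k + 1))).trans (le_of_eq ?_)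
    have e2 : ∀ i, k + 1 + i = k + (i + 1) := fun i => by omega
    simp only [e2, add_zero]
    ring

/-- The error of implicit Euler for smooth data. -/
lemma norm_sub_pow_mul_le (hT : IsC0Semigroup T) (hG : GeneratesNegInverse T B)
    (hB : IsAccretive B) (hd : DenseRange B) (hτ : 0 < τ) (hr : IsImplicitEuler τ B r)
    (hr1 : ‖r‖ ≤ 1) (hM1 : 1 ≤ M) (hM : IsSmoothing M r) {n : ℕ} (hn : 1 ≤ n) :
    ‖(T (n * τ) - r ^ n) * B‖ ≤ 4 * M * ((1 + Real.log n) * τ) := by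
  obtain ⟨m, rfl⟩ : ∃ m, n = m + 1 := ⟨n - 1, by omega⟩
  rw [hT.apply_nat_mul hτ.le]
  have e : (T τ ^ (m + 1) - r ^ (m + 1)) * B
      = T τ ^ m * ((T τ - r) * B) + (T τ ^ m - r ^ m) * r ^ (0 + 1) * B := by
    rw [pow_succ (T τ) m, pow_succ r m, zero_add, pow_one]; noncomm_ring
  rw [e]
  have h1 : ‖T τ ^ m‖ ≤ 1 := norm_pow_le_one ContinuousLinearMap.norm_id_le
    (hT.norm_le_one hG hB hd hτ.le) m
  refine (norm_add_le_of_le (norm_mul_le_of_le h1 (hT.norm_sub_mul_le hG hB hd hτ hr hr1))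
    (hT.norm_pow_sub_pow_mul_pow_mul_le hG hB hd hτ hr hr1 hM m 0)).trans ?_
  have hs : ∑ i ∈ Finset.range m, (((0 + i : ℕ) : ℝ) + 1)⁻¹ ≤ 1 + Real.log (m + 1 : ℕ) := by
    have h := harmonic_le_one_add_log (m + 1)
    rw [harmonic, Finset.sum_range_succ] at h
    push_cast at h ⊢
    simp only [zero_add]
    have : (0 : ℝ) ≤ ((m : ℝ) + 1)⁻¹ := by positivity
    linarith
  have hlog : 0 ≤ Real.log (m + 1 : ℕ) := Real.log_natCast_nonneg _
  have h2 : 2 * τ ≤ 2 * M * ((1 + Real.log (m + 1 : ℕ)) * τ) := by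
    have : 1 ≤ M * (1 + Real.log (m + 1 : ℕ)) := one_le_mul_of_one_le_of_one_le hM1 (by linarith)
    nlinarith
  have h3 : 2 * τ * M * ∑ i ∈ Finset.range m, (((0 + i : ℕ) : ℝ) + 1)⁻¹
      ≤ 2 * τ * M * (1 + Real.log (m + 1 : ℕ)) := by gcongr
  linarith

end IsC0Semigroup

end Semigroup

/-! ### Generation of contraction semigroups -/

section Yosida

variable {H : Type*} [NormedAddCommGroup H] [InnerProductSpace ℝ H]

/-- Strong convergence on a dense range extends to the whole space for uniformly bounded
operators. -/
lemma tendsto_of_denseRange {ι X : Type*} {l : Filter ι} {F : ι → H →L[ℝ] H} {G : H →L[ℝ] H}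
    (hF : ∀ᶠ i in l, ‖F i‖ ≤ 1) (hG : ‖G‖ ≤ 1) {g : X → H} (hd : DenseRange g)
    (h : ∀ z, Tendsto (fun i => F i (g z)) l (𝓝 (G (g z)))) (x : H) :
    Tendsto (fun i => F i x) l (𝓝 (G x)) := by
  rw [Metric.tendsto_nhds]
  intro ε hε
  obtain ⟨z, hz⟩ := hd.exists_dist_lt x (by positivity : 0 < ε / 3)
  filter_upwards [hF, Metric.tendsto_nhds.1 (h z) (ε / 3) (by positivity)] with i hi hi'
  have h1 : dist (F i x) (F i (g z)) ≤ dist x (g z) := by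
    rw [dist_eq_norm, dist_eq_norm, ← map_sub]; simpa using (F i).le_of_opNorm_le hi (x - g z)
  have h2 : dist (G (g z)) (G x) ≤ dist x (g z) := by
    rw [dist_comm, dist_eq_norm, dist_eq_norm, ← map_sub]
    simpa using G.le_of_opNorm_le hG (x - g z)
  have := dist_triangle4 (F i x) (F i (g z)) (G (g z)) (G x)
  linarith

lemma cauchySeq_of_denseRange {X : Type*} {F : ℕ → H →L[ℝ] H}
    (hF : ∀ i, ‖F i‖ ≤ 1) {g : X → H} (hd : DenseRange g)
    (h : ∀ z, CauchySeq fun i => F i (g z)) (x : H) : CauchySeq fun i => F i x := by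
  rw [Metric.cauchySeq_iff]
  intro ε hε
  obtain ⟨z, hz⟩ := hd.exists_dist_lt x (by positivity : 0 < ε / 3)
  obtain ⟨N, hN⟩ := Metric.cauchySeq_iff.1 (h z) (ε / 3) (by positivity)
  have key : ∀ i, dist (F i x) (F i (g z)) ≤ dist x (g z) := fun i => by
    rw [dist_eq_norm, dist_eq_norm, ← map_sub]; simpa using (F i).le_of_opNorm_le (hF i) (x - g z)
  refine ⟨N, fun m hm n hn => ?_⟩
  have h1 := key m
  have h2 := key n
  rw [dist_comm] at h2
  have := hN m hm n hn
  have := dist_triangle4 (F m x) (F m (g z)) (F n (g z)) (F n x)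
  linarith

/-- The semigroup `exp (-t L)` of a bounded operator `L`. -/
noncomputable def expSemigroup (L : H →L[ℝ] H) (t : ℝ) : H →L[ℝ] H := NormedSpace.exp (t • (-L))

section Bounded

variable {L L' : H →L[ℝ] H}

lemma expSemigroup_zero : expSemigroup L 0 = 1 := by
  simp [expSemigroup]

lemma expSemigroup_commute (h : Commute L L') (t : ℝ) : Commute (expSemigroup L t) L' :=
  ((h.neg_left).smul_left t).exp_left

variable [CompleteSpace H]

lemma expSemigroup_add (s t : ℝ) :
    expSemigroup L (s + t) = expSemigroup L s * expSemigroup L t := by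
  let _ : NormedAlgebra ℚ (H →L[ℝ] H) := NormedAlgebra.restrictScalars ℚ ℝ _
  rw [expSemigroup, add_smul]
  exact NormedSpace.exp_add_of_commute (((Commute.refl (-L)).smul_left s).smul_right t)

lemma hasDerivAt_expSemigroup (t : ℝ) :
    HasDerivAt (expSemigroup L) (expSemigroup L t * (-L)) t :=
  hasDerivAt_exp_smul_const (-L) t

lemma hasDerivAt_expSemigroup_apply (x : H) (t : ℝ) :
    HasDerivAt (fun s => expSemigroup L s x) (-(expSemigroup L t (L x))) t := by
  have := (hasDerivAt_expSemigroup (L := L) t).clm_apply (hasDerivAt_const t x)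
  simpa using this

lemma continuous_expSemigroup_apply (x : H) : Continuous fun s => expSemigroup L s x :=
  continuous_iff_continuousAt.2 fun t => (hasDerivAt_expSemigroup_apply x t).continuousAt

lemma norm_expSemigroup_apply_le (hL : IsAccretive L) {t : ℝ} (ht : 0 ≤ t) (x : H) :
    ‖expSemigroup L t x‖ ≤ ‖x‖ := by
  have h := norm_le_of_inner_deriv_right_nonpos (u := fun s => expSemigroup L s x)
    (u' := fun s => -(expSemigroup L s (L x))) ht (continuous_expSemigroup_apply x).continuousOn
    (fun s _ => (hasDerivAt_expSemigroup_apply x s).hasDerivWithinAt) fun s _ => by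
      have e : expSemigroup L s (L x) = L (expSemigroup L s x) :=
        congr($((expSemigroup_commute (Commute.refl L) s).eq) x)
      rw [e, inner_neg_right, real_inner_comm]
      have := hL (expSemigroup L s x)
      linarith
  simpa [expSemigroup_zero] using h

lemma norm_expSemigroup_le (hL : IsAccretive L) {t : ℝ} (ht : 0 ≤ t) : ‖expSemigroup L t‖ ≤ 1 :=
  ContinuousLinearMap.opNorm_le_bound _ zero_le_one fun x => by
    simpa using norm_expSemigroup_apply_le hL ht x

lemma norm_expSemigroup_apply_sub_le (hL : IsAccretive L) {t : ℝ} (ht : 0 ≤ t) (x : H) :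
    ‖expSemigroup L t x - x‖ ≤ t * ‖L x‖ := by
  have h := norm_image_sub_le_of_norm_deriv_right_le_segment (f := fun s => expSemigroup L s x)
    (f' := fun s => -(expSemigroup L s (L x))) (C := ‖L x‖) (a := 0) (b := t)
    (continuous_expSemigroup_apply x).continuousOn
    (fun s _ => (hasDerivAt_expSemigroup_apply x s).hasDerivWithinAt)
    (fun s hs => by rw [norm_neg]; exact norm_expSemigroup_apply_le hL hs.1 _) t
    (Set.right_mem_Icc.2 ht)
  simpa [expSemigroup_zero, mul_comm] using h

lemma norm_expSemigroup_apply_sub_add_le (hL : IsAccretive L) {t : ℝ} (ht : 0 ≤ t) (x : H) :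
    ‖expSemigroup L t x - x + t • L x‖ ≤ t ^ 2 * ‖L (L x)‖ := by
  have h := norm_image_sub_le_of_norm_deriv_right_le_segment
    (f := fun s => expSemigroup L s x + s • L x)
    (f' := fun s => -(expSemigroup L s (L x)) + (1 : ℝ) • L x) (C := t * ‖L (L x)‖)
    (a := 0) (b := t)
    ((continuous_expSemigroup_apply x).add (by fun_prop)).continuousOn
    (fun s _ => ((hasDerivAt_expSemigroup_apply x s).add
      ((hasDerivAt_id s).smul_const (L x))).hasDerivWithinAt)
    (fun s hs => by
      rw [one_smul, neg_add_eq_sub, norm_sub_rev]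
      refine (norm_expSemigroup_apply_sub_le hL hs.1 _).trans ?_
      have := hs.2.le
      gcongr) t
    (Set.right_mem_Icc.2 ht)
  have e : expSemigroup L t x - x + t • L x
      = expSemigroup L t x + t • L x - (expSemigroup L 0 x + (0 : ℝ) • L x) := by
    rw [expSemigroup_zero]; simp; abel
  rw [e]
  refine h.trans (le_of_eq ?_)
  ring

/-- The derivative of `s ↦ exp (-s L) exp (-(t - s) L')` is
`exp (-s L) exp (-(t - s) L') (L' - L)` for commuting operators. -/
lemma norm_expSemigroup_sub_apply_le (hL : IsAccretive L) (hL' : IsAccretive L')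
    (hc : Commute L L') {t : ℝ} (ht : 0 ≤ t) (x : H) :
    ‖expSemigroup L t x - expSemigroup L' t x‖ ≤ t * ‖(L' - L) x‖ := by
  have hder : ∀ s, HasDerivAt (fun s => (expSemigroup L s * expSemigroup L' (t - s)) x)
      ((expSemigroup L s * expSemigroup L' (t - s)) ((L' - L) x)) s := by
    intro s
    have h1 := (hasDerivAt_expSemigroup (L := L) s).mul
      ((hasDerivAt_expSemigroup (L := L') (t - s)).scomp s ((hasDerivAt_id s).const_sub t))
    have h2 := h1.clm_apply (hasDerivAt_const s x)
    refine h2.congr_deriv ?_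
    have e : expSemigroup L s * -L * expSemigroup L' (t - s)
        = -(expSemigroup L s * expSemigroup L' (t - s) * L) := by
      rw [mul_assoc, mul_assoc, (expSemigroup_commute hc.symm (t - s)).eq]; simp
    simp only [map_zero, add_zero, Function.comp_apply]
    rw [e]
    simp
    abel
  have h := norm_image_sub_le_of_norm_deriv_right_le_segment (C := ‖(L' - L) x‖) (a := 0) (b := t)
    (fun s _ => (hder s).continuousAt.continuousWithinAt)
    (fun s _ => (hder s).hasDerivWithinAt)
    (fun s hs => by
      refine (norm_expSemigroup_apply_le hL hs.1 _).trans ?_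
      exact norm_expSemigroup_apply_le hL' (sub_nonneg.2 hs.2.le) _) t
    (Set.right_mem_Icc.2 ht)
  simpa [expSemigroup_zero, mul_comm] using h

end Bounded

section ImplicitEulerOfInverse

variable {B : H →L[ℝ] H} {τ : ℝ}

/-- The implicit Euler step `(1 + τ B⁻¹)⁻¹ = 1 - (1 + τ⁻¹ B)⁻¹`. -/
noncomputable def eulerStep (B : H →L[ℝ] H) (τ : ℝ) : H →L[ℝ] H := 1 - resolv B τ⁻¹

/-- The Yosida approximation `B⁻¹ (1 + τ B⁻¹)⁻¹ = τ⁻¹ (1 + τ⁻¹ B)⁻¹` of `B⁻¹`. -/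
noncomputable def yosida (B : H →L[ℝ] H) (τ : ℝ) : H →L[ℝ] H := τ⁻¹ • resolv B τ⁻¹

lemma yosida_commute (σ τ : ℝ) : Commute (yosida B σ) (yosida B τ) := by
  have h : Commute (1 + σ⁻¹ • B) (1 + τ⁻¹ • B) :=
    ((Commute.one_left _).add_left
      (((Commute.one_right _).add_right ((Commute.refl B).smul_right _)).smul_left _))
  exact (h.ringInverse_ringInverse.smul_left _).smul_right _

variable [CompleteSpace H]

lemma isImplicitEuler_eulerStep (hB : IsAccretive B) (hτ : 0 < τ) :
    IsImplicitEuler τ B (eulerStep B τ) := by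
  have h0 : (0 : ℝ) ≤ τ⁻¹ := by positivity
  constructor
  · rw [eulerStep, sub_sub_cancel, ← hB.smul_mul_resolv h0, smul_mul_assoc,
      smul_inv_smul₀ hτ.ne']
  · rw [eulerStep, sub_sub_cancel, ← hB.resolv_mul_smul h0, mul_smul_comm, smul_inv_smul₀ hτ.ne']

lemma norm_eulerStep_le (hB : IsAccretive B) (hτ : 0 < τ) : ‖eulerStep B τ‖ ≤ 1 :=
  hB.norm_one_sub_resolv_le (by positivity)

lemma isAccretive_yosida (hB : IsAccretive B) (hτ : 0 < τ) : IsAccretive (yosida B τ) := fun x => by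
  have h0 : (0 : ℝ) ≤ τ⁻¹ := by positivity
  rw [yosida, smul_apply, real_inner_smul_left]
  exact mul_nonneg h0 (hB.resolv_pos h0 x)

lemma yosida_mul (hB : IsAccretive B) (hτ : 0 < τ) : yosida B τ * B = eulerStep B τ := by
  rw [yosida, eulerStep, ← hB.resolv_mul_smul (by positivity : (0 : ℝ) ≤ τ⁻¹), smul_mul_assoc,
    mul_smul_comm]

lemma norm_eulerStep_apply_sub_le (hB : IsAccretive B) (hτ : 0 < τ) (z : H) :
    ‖eulerStep B τ (B z) - B z‖ ≤ τ * ‖z‖ := by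
  have h := congr($((isImplicitEuler_eulerStep hB hτ).right) z)
  have e : eulerStep B τ (B z) - B z = -(τ • eulerStep B τ z) := by
    have : B z - eulerStep B τ (B z) = τ • eulerStep B τ z := by simpa using h
    rw [← this]; abel
  rw [e, norm_neg, norm_smul, Real.norm_of_nonneg hτ.le]
  gcongr
  simpa using (eulerStep B τ).le_of_opNorm_le (norm_eulerStep_le hB hτ) z

end ImplicitEulerOfInverse

variable [CompleteSpace H]

/-- Generation of contraction semigroups: for accretive `B` with dense range, `-B⁻¹` generates a
strongly continuous semigroup. It is the limit of the semigroups of the Yosida approximations. -/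
theorem exists_semigroup {B : H →L[ℝ] H} (hB : IsAccretive B) (hd : DenseRange B) :
    ∃ T : ℝ → H →L[ℝ] H, IsC0Semigroup T ∧ GeneratesNegInverse T B := by
  set ε : ℕ → ℝ := fun n => 1 / (n + 1) with hε
  have hε0 : ∀ n, 0 < ε n := fun n => by positivity
  have hεlim : Tendsto ε atTop (𝓝 0) := tendsto_one_div_add_atTop_nhds_zero_nat
  set L : ℕ → H →L[ℝ] H := fun n => yosida B (ε n)
  set U : ℕ → ℝ → H →L[ℝ] H := fun n => expSemigroup (L n) with hU
  set r : ℕ → H →L[ℝ] H := fun n => eulerStep B (ε n)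
  have hL : ∀ n, IsAccretive (L n) := fun n => isAccretive_yosida hB (hε0 n)
  have hLB : ∀ n x, L n (B x) = r n x := fun n x => congr($(yosida_mul hB (hε0 n)) x)
  have hr1 : ∀ n x, ‖r n x‖ ≤ ‖x‖ := fun n x => by
    simpa using (r n).le_of_opNorm_le (norm_eulerStep_le hB (hε0 n)) x
  have hrB : ∀ n z, ‖r n (B z) - B z‖ ≤ ε n * ‖z‖ := fun n z =>
    norm_eulerStep_apply_sub_le hB (hε0 n) z
  have hrlim : ∀ z, Tendsto (fun n => r n (B z)) atTop (𝓝 (B z)) := fun z => by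
    rw [tendsto_iff_norm_sub_tendsto_zero]
    refine squeeze_zero (fun _ => norm_nonneg _) (fun n => hrB n z) ?_
    simpa using hεlim.mul_const ‖z‖
  have hd2 : DenseRange fun z => B (B z) := hd.comp hd B.continuous
  have hcauchy : ∀ t, 0 ≤ t → ∀ x, CauchySeq fun n => U n t x := by
    intro t ht
    refine cauchySeq_of_denseRange (fun n => norm_expSemigroup_le (hL n) ht) hd2 fun z => ?_
    have hb : ∀ n m, dist (U n t (B (B z))) (U m t (B (B z))) ≤ t * ((ε n + ε m) * ‖z‖) := by
      intro n m
      rw [dist_eq_norm]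
      refine (norm_expSemigroup_sub_apply_le (hL n) (hL m) (yosida_commute _ _) ht _).trans ?_
      gcongr
      rw [sub_apply, hLB, hLB]
      have e : r m (B z) - r n (B z) = (r m (B z) - B z) - (r n (B z) - B z) := by abel
      rw [e]
      exact (norm_sub_le_of_le (hrB m z) (hrB n z)).trans (by linarith)
    refine cauchySeq_of_le_tendsto_0 (fun N => t * ((ε N + ε N) * ‖z‖)) (fun n m N hn hm => ?_) ?_
    · refine (hb n m).trans ?_
      have h1 : ε n ≤ ε N := one_div_le_one_div_of_le (by positivity) (by gcongr)
      have h2 : ε m ≤ ε N := one_div_le_one_div_of_le (by positivity) (by gcongr)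
      gcongr
    · simpa using ((hεlim.add hεlim).mul_const ‖z‖).const_mul t
  have hex : ∀ t : ℝ, ∃ Tt : H →L[ℝ] H, 0 ≤ t → ∀ x,
      Tendsto (fun n => U n t x) atTop (𝓝 (Tt x)) := by
    intro t
    by_cases ht : 0 ≤ t
    · choose f hf using fun x => cauchySeq_tendsto_of_complete (hcauchy t ht x)
      exact ⟨continuousLinearMapOfTendsto (fun n => U n t) (tendsto_pi_nhds.2 hf), fun _ => hf⟩
    · exact ⟨0, fun h => absurd h ht⟩
  choose T hT using hex
  have hT1 : ∀ t, 0 ≤ t → ∀ x, ‖T t x‖ ≤ ‖x‖ := fun t ht x =>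
    le_of_tendsto (hT t ht x).norm (Eventually.of_forall fun n =>
      norm_expSemigroup_apply_le (hL n) ht x)
  have hTn : ∀ t, 0 ≤ t → ‖T t‖ ≤ 1 := fun t ht =>
    ContinuousLinearMap.opNorm_le_bound _ zero_le_one fun x => by simpa using hT1 t ht x
  have hTB : ∀ t, 0 ≤ t → ∀ z, ‖T t (B z) - B z‖ ≤ t * ‖z‖ := fun t ht z =>
    le_of_tendsto ((hT t ht (B z)).sub_const (B z)).norm (Eventually.of_forall fun n => by
      refine (norm_expSemigroup_apply_sub_le (hL n) ht (B z)).trans ?_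
      rw [hLB]
      gcongr
      exact hr1 n z)
  have hTBB : ∀ t, 0 ≤ t → ∀ z, ‖T t (B (B z)) - B (B z) + t • B z‖ ≤ t ^ 2 * ‖z‖ := fun t ht z =>
    le_of_tendsto (((hT t ht (B (B z))).sub_const (B (B z))).add ((hrlim z).const_smul t)).norm
      (Eventually.of_forall fun n => by
        have h := norm_expSemigroup_apply_sub_add_le (hL n) ht (B (B z))
        rw [hLB] at h
        refine h.trans ?_
        have e : L n (r n (B z)) = r n (r n z) := by
          have : r n (B z) = B (r n z) :=
            congr($((isImplicitEuler_eulerStep hB (hε0 n)).comm.eq) z).symm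
          rw [this, hLB]
        rw [e]
        gcongr
        exact (hr1 n _).trans (hr1 n z))
  have hsemi : IsC0Semigroup T := by
    refine ⟨?_, fun s t hs ht => ?_, fun x => ?_⟩
    · ext x
      refine tendsto_nhds_unique (hT 0 le_rfl x) ?_
      simp [hU, expSemigroup_zero]
    · ext x
      refine tendsto_nhds_unique (hT (s + t) (by positivity) x) ?_
      have h1 : Tendsto (fun n => U n s (U n t x - T t x)) atTop (𝓝 0) := by
        refine squeeze_zero_norm (fun n => norm_expSemigroup_apply_le (hL n) hs _) ?_
        exact tendsto_iff_norm_sub_tendsto_zero.1 (hT t ht x)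
      have h2 := h1.add (hT s hs (T t x))
      rw [zero_add] at h2
      refine h2.congr fun n => ?_
      rw [map_sub, sub_add_cancel, hU]
      simp only [expSemigroup_add]
      rfl
    · refine tendsto_of_denseRange (G := 1) (F := T) ?_ ContinuousLinearMap.norm_id_le hd
        (fun z => ?_) x
      · filter_upwards [self_mem_nhdsWithin] with t ht using hTn t (le_of_lt ht)
      · rw [tendsto_iff_norm_sub_tendsto_zero]
        refine squeeze_zero' (Eventually.of_forall fun _ => norm_nonneg _)
          (g := fun t => t * ‖z‖) ?_ ?_
        · filter_upwards [self_mem_nhdsWithin] with t ht using hTB t (le_of_lt ht) z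
        · have : Tendsto (fun t : ℝ => t * ‖z‖) (𝓝 0) (𝓝 (0 * ‖z‖)) :=
            tendsto_id.mul_const _
          rw [zero_mul] at this
          exact this.mono_left inf_le_left
  have hgen : ∀ y, Tendsto (fun t : ℝ => t⁻¹ • (T t (B y) - B y)) (𝓝[>] 0) (𝓝 (-y)) := by
    refine tendsto_of_denseRange (G := -1) (F := fun t => t⁻¹ • (T t * B - B)) ?_
      (by rw [norm_neg]; exact ContinuousLinearMap.norm_id_le) hd fun z => ?_
    · filter_upwards [self_mem_nhdsWithin] with t ht
      have ht : 0 < t := ht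
      rw [norm_smul, Real.norm_of_nonneg (by positivity), inv_mul_le_one₀ ht]
      exact ContinuousLinearMap.opNorm_le_bound _ ht.le fun z => hTB t ht.le z
    · rw [tendsto_iff_norm_sub_tendsto_zero]
      refine squeeze_zero' (Eventually.of_forall fun _ => norm_nonneg _)
        (g := fun t => t * ‖z‖) ?_ ?_
      · filter_upwards [self_mem_nhdsWithin] with t ht
        have ht : 0 < t := ht
        have e : (t⁻¹ • (T t * B - B)) (B z) - (-1 : H →L[ℝ] H) (B z)
            = t⁻¹ • (T t (B (B z)) - B (B z) + t • B z) := by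
          rw [smul_add, inv_smul_smul₀ ht.ne']; simp
        rw [e, norm_smul, Real.norm_of_nonneg (by positivity), inv_mul_le_iff₀ ht]
        exact (hTBB t ht.le z).trans (le_of_eq (by ring))
      · have : Tendsto (fun t : ℝ => t * ‖z‖) (𝓝 0) (𝓝 (0 * ‖z‖)) :=
          tendsto_id.mul_const _
        rw [zero_mul] at this
        exact this.mono_left inf_le_left
  refine ⟨T, hsemi, fun x y => ⟨fun h => ?_, fun h => ?_⟩⟩
  · have h1 := hgen (-y)
    rw [map_neg, h, neg_neg, neg_neg] at h1
    exact h1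
  · -- `x' = (1 + B⁻¹)⁻¹ (x - y)` has `B⁻¹ x' = x - y - x'`, and `x - x'` is an eigenvector of the
    -- generator with eigenvalue `1`, hence zero.
    obtain ⟨w, hw⟩ : ∃ w, w + B w = x - y :=
      ⟨resolv B 1 (x - y), by simpa using hB.resolv_add_apply zero_le_one (x - y)⟩
    set d := x - B w with hdd
    have h1 : Tendsto (fun t : ℝ => t⁻¹ • (T t d - d)) (𝓝[>] 0) (𝓝 d) := by
      have h2 := h.sub (hgen w)
      have e : y - -w = d := by
        rw [hdd, sub_neg_eq_add, ← sub_eq_zero]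
        have : y + w - (x - B w) = (w + B w) - (x - y) := by abel
        rw [this, hw, sub_self]
      rw [e] at h2
      refine h2.congr fun t => ?_
      rw [← smul_sub, hdd, map_sub]
      congr 1
      abel
    have h3 : inner ℝ d d ≤ 0 := by
      refine le_of_tendsto (h1.inner tendsto_const_nhds) ?_
      filter_upwards [self_mem_nhdsWithin] with t ht
      have ht : 0 < t := ht
      rw [real_inner_smul_left, inner_sub_left]
      refine mul_nonpos_of_nonneg_of_nonpos (by positivity) ?_
      have h4 := real_inner_le_norm (T t d) d
      have h5 := mul_le_mul_of_nonneg_right (hT1 t ht.le d) (norm_nonneg d)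
      rw [real_inner_self_eq_norm_mul_norm]
      linarith
    have h4 : d = 0 := inner_self_eq_zero.1 (le_antisymm h3 real_inner_self_nonneg)
    have hx : x = B w := sub_eq_zero.1 h4
    have hwy : w = -y := by
      rw [hx] at hw
      have : w = (w + B w) - B w := by abel
      rw [this, hw]; abel
    rw [hx, hwy]; simp

end Yosida

/-! ### Interpolation along the fractional powers -/

open MeasureTheory

section Interpolation

/-- The integral estimate behind interpolation: one cuts the integral where the two bounds for `F`
agree, at `s = b / a`. The factor `sin (πθ) / π` compensates the poles at `θ = 0` and `θ = 1`. -/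
lemma integrableOn_rpow_smul_and_norm_le {F : Type*} [NormedAddCommGroup F] [NormedSpace ℝ F]
    {f : ℝ → F} (hf : ContinuousOn f (Set.Ioi 0)) {a b θ : ℝ} (ha : 0 < a) (hb : 0 < b)
    (hθ0 : 0 < θ) (hθ1 : θ < 1) (hfa : ∀ s, 0 < s → ‖f s‖ ≤ a) (hfb : ∀ s, 0 < s → ‖f s‖ ≤ b / s) :
    IntegrableOn (fun s : ℝ => s ^ (-θ) • f s) (Set.Ioi 0) ∧
      ‖(Real.sin (Real.pi * θ) / Real.pi) • ∫ s in Set.Ioi (0 : ℝ), s ^ (-θ) • f s‖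
        ≤ 2 * (a ^ θ * b ^ (1 - θ)) := by
  set δ : ℝ := b / a
  have hδ : 0 < δ := div_pos hb ha
  have hcont : ContinuousOn (fun s : ℝ => s ^ (-θ) • f s) (Set.Ioi 0) :=
    (ContinuousOn.rpow_const continuousOn_id fun s hs => Or.inl (ne_of_gt hs)).smul hf
  have hint1 : IntegrableOn (fun s : ℝ => a * s ^ (-θ)) (Set.Ioc 0 δ) :=
    ((intervalIntegral.intervalIntegrable_rpow' (by linarith : -1 < -θ)).1).const_mul a
  have hint2 : IntegrableOn (fun s : ℝ => b * s ^ (-θ - 1)) (Set.Ioi δ) :=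
    (integrableOn_Ioi_rpow_of_lt (by linarith) hδ).const_mul b
  have hbd1 : ∀ᵐ s ∂volume.restrict (Set.Ioc 0 δ), ‖s ^ (-θ) • f s‖ ≤ a * s ^ (-θ) := by
    filter_upwards [ae_restrict_mem measurableSet_Ioc] with s hs
    have h0 : 0 ≤ s ^ (-θ) := Real.rpow_nonneg hs.1.le _
    rw [norm_smul, Real.norm_of_nonneg h0, mul_comm]
    exact mul_le_mul_of_nonneg_right (hfa s hs.1) h0
  have hbd2 : ∀ᵐ s ∂volume.restrict (Set.Ioi δ), ‖s ^ (-θ) • f s‖ ≤ b * s ^ (-θ - 1) := by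
    filter_upwards [ae_restrict_mem measurableSet_Ioi] with s hs
    have hs0 : 0 < s := hδ.trans hs
    have h0 : 0 ≤ s ^ (-θ) := Real.rpow_nonneg hs0.le _
    rw [norm_smul, Real.norm_of_nonneg h0, Real.rpow_sub_one hs0.ne']
    calc _ ≤ s ^ (-θ) * (b / s) := mul_le_mul_of_nonneg_left (hfb s hs0) h0
      _ = _ := by ring
  have hi1 : IntegrableOn (fun s : ℝ => s ^ (-θ) • f s) (Set.Ioc 0 δ) :=
    hint1.mono' ((hcont.mono Set.Ioc_subset_Ioi_self).aestronglyMeasurable measurableSet_Ioc) hbd1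
  have hi2 : IntegrableOn (fun s : ℝ => s ^ (-θ) • f s) (Set.Ioi δ) :=
    hint2.mono' ((hcont.mono (Set.Ioi_subset_Ioi hδ.le)).aestronglyMeasurable measurableSet_Ioi)
      hbd2
  have hU : Set.Ioi (0 : ℝ) = Set.Ioc 0 δ ∪ Set.Ioi δ := (Set.Ioc_union_Ioi_eq_Ioi hδ.le).symm
  refine ⟨by rw [hU]; exact hi1.union hi2, ?_⟩
  have e1 : ∫ s in Set.Ioc 0 δ, a * s ^ (-θ) = (a ^ θ * b ^ (1 - θ)) / (1 - θ) := by
    rw [integral_const_mul, ← intervalIntegral.integral_of_le hδ.le,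
      integral_rpow (Or.inl (by linarith)), Real.zero_rpow (by linarith), sub_zero,
      show -θ + 1 = 1 - θ by ring, Real.div_rpow hb.le ha.le, Real.rpow_sub ha, Real.rpow_one]
    have := Real.rpow_pos_of_pos ha θ
    field_simp
  have e2 : ∫ s in Set.Ioi δ, b * s ^ (-θ - 1) = (a ^ θ * b ^ (1 - θ)) / θ := by
    rw [integral_const_mul, integral_Ioi_rpow_of_lt (by linarith) hδ, sub_add_cancel,
      Real.rpow_neg hδ.le, Real.div_rpow hb.le ha.le, Real.rpow_sub hb, Real.rpow_one]
    have := Real.rpow_pos_of_pos ha θ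
    have := Real.rpow_pos_of_pos hb θ
    field_simp
  have hn : ‖∫ s in Set.Ioi (0 : ℝ), s ^ (-θ) • f s‖
      ≤ (a ^ θ * b ^ (1 - θ)) / (1 - θ) + (a ^ θ * b ^ (1 - θ)) / θ := by
    rw [hU, setIntegral_union (Set.Ioc_disjoint_Ioi le_rfl) measurableSet_Ioi hi1 hi2, ← e1, ← e2]
    exact norm_add_le_of_le (norm_integral_le_of_norm_le hint1 hbd1)
      (norm_integral_le_of_norm_le hint2 hbd2)
  have hpi := Real.pi_pos
  have hs0 : 0 ≤ Real.sin (Real.pi * θ) :=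
    Real.sin_nonneg_of_nonneg_of_le_pi (by positivity) (by nlinarith)
  have hs1 : Real.sin (Real.pi * θ) ≤ Real.pi * θ := Real.sin_le (by positivity)
  have hs2 : Real.sin (Real.pi * θ) ≤ Real.pi * (1 - θ) := by
    have : Real.sin (Real.pi * θ) = Real.sin (Real.pi * (1 - θ)) := by
      rw [← Real.sin_pi_sub]; congr 1; ring
    rw [this]
    exact Real.sin_le (by have : 0 < 1 - θ := by linarith
                          positivity)
  have hk1 : Real.sin (Real.pi * θ) / Real.pi ≤ θ := (div_le_iff₀ hpi).2 (by linarith)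
  have hk2 : Real.sin (Real.pi * θ) / Real.pi ≤ 1 - θ := (div_le_iff₀ hpi).2 (by linarith)
  have hab : 0 ≤ a ^ θ * b ^ (1 - θ) := by positivity
  have h1θ : 0 < 1 - θ := by linarith
  rw [norm_smul, Real.norm_of_nonneg (by positivity)]
  calc _ ≤ Real.sin (Real.pi * θ) / Real.pi
        * ((a ^ θ * b ^ (1 - θ)) / (1 - θ) + (a ^ θ * b ^ (1 - θ)) / θ) := by gcongr
    _ = Real.sin (Real.pi * θ) / Real.pi * ((a ^ θ * b ^ (1 - θ)) / (1 - θ))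
        + Real.sin (Real.pi * θ) / Real.pi * ((a ^ θ * b ^ (1 - θ)) / θ) := by ring
    _ ≤ (1 - θ) * ((a ^ θ * b ^ (1 - θ)) / (1 - θ)) + θ * ((a ^ θ * b ^ (1 - θ)) / θ) := by
      gcongr
    _ = _ := by field_simp; ring

end Interpolation

section Inverse

variable {E : Type*} [NormedAddCommGroup E] [NormedSpace ℝ E] {T : E →ₗ.[ℝ] E} {R R' : E →L[ℝ] E}

lemma IsBoundedInverse.unique (h : IsBoundedInverse T R) (h' : IsBoundedInverse T R') :
    R = R' := by
  ext y
  obtain ⟨hy, e⟩ := h.1 y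
  have := h'.2 ⟨R y, hy⟩
  rw [e] at this
  exact this.symm

lemma IsBoundedInverse.boundedInverse_eq (h : IsBoundedInverse T R) : boundedInverse T = R := by
  have hex : ∃ R : E →L[ℝ] E, IsBoundedInverse T R := ⟨R, h⟩
  rw [boundedInverse, dif_pos hex]
  exact hex.choose_spec.unique h

end Inverse

section PositiveOperator

variable {H : Type*} [NormedAddCommGroup H] [InnerProductSpace ℝ H]
  {A : H →ₗ.[ℝ] H} {B : H →L[ℝ] H}

lemma IsPositiveSectorial.isBoundedInverse (hA : IsPositiveSectorial A) :
    IsBoundedInverse A (boundedInverse A) := by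
  obtain ⟨R, hR⟩ := hA.zero_mem_resolvent
  rwa [hR.boundedInverse_eq]

lemma IsPositiveSectorial.isAccretive_inverse (hA : IsPositiveSectorial A)
    (hB : IsBoundedInverse A B) : IsAccretive B := fun y => by
  obtain ⟨hy, e⟩ := hB.1 y
  by_cases h0 : B y = 0
  · rw [h0, inner_zero_left]
  · have := hA.positive ⟨B y, hy⟩ h0
    rw [e, real_inner_comm] at this
    exact this.le

lemma IsPositiveSectorial.denseRange_inverse (hA : IsPositiveSectorial A)
    (hB : IsBoundedInverse A B) : DenseRange B :=
  hA.dense.mono fun x hx => ⟨A ⟨x, hx⟩, hB.2 ⟨x, hx⟩⟩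

lemma isGenerator_neg_iff (hB : IsBoundedInverse A B) {T : ℝ → H →L[ℝ] H} :
    IsGenerator T (-A) ↔ GeneratesNegInverse T B := by
  have key : ∀ x y : H, (x, y) ∈ (-A).graph ↔ B y = -x := by
    intro x y
    rw [LinearPMap.mem_graph_iff]
    constructor
    · rintro ⟨v, rfl, hv⟩
      have h1 : A ⟨v, v.2⟩ = -y := by
        have : -(A ⟨v, v.2⟩) = y := hv
        rw [← this, neg_neg]
      have h2 := hB.2 ⟨v, v.2⟩
      rw [h1, map_neg] at h2
      rw [← neg_eq_iff_eq_neg]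
      exact h2
    · intro h
      obtain ⟨hy, e⟩ := hB.1 (-y)
      have hx : B (-y) = x := by rw [map_neg, h, neg_neg]
      refine ⟨⟨B (-y), hy⟩, hx, ?_⟩
      have : -(A ⟨B (-y), hy⟩) = y := by rw [e, neg_neg]
      exact this
  exact forall₂_congr fun x y => by rw [key]

variable [CompleteSpace H]

/-- The semigroup `expNeg A` exists and is the one generated by `-A`. -/
lemma expNeg_spec (hB : IsBoundedInverse A B) (hacc : IsAccretive B) (hd : DenseRange B) :
    IsC0Semigroup (expNeg A) ∧ GeneratesNegInverse (expNeg A) B := by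
  obtain ⟨T, hT, hG⟩ := exists_semigroup hacc hd
  have hex : ∃ T : ℝ → H →L[ℝ] H, IsC0Semigroup T ∧ IsGenerator T (-A) :=
    ⟨T, hT, (isGenerator_neg_iff hB).2 hG⟩
  have e : expNeg A = hex.choose := by
    funext t; rw [expNeg, dif_pos hex]
  rw [e, ← isGenerator_neg_iff hB]
  exact hex.choose_spec

lemma isBoundedInverse_realShift (hB : IsBoundedInverse A B) (hacc : IsAccretive B) {s : ℝ}
    (hs : 0 ≤ s) : IsBoundedInverse (realShift A s) (B * resolv B s) := by
  constructor
  · intro y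
    obtain ⟨hy, e⟩ := hB.1 (resolv B s y)
    refine ⟨hy, ?_⟩
    have : s • B (resolv B s y) + A ⟨B (resolv B s y), hy⟩ = y := by
      rw [e, add_comm]; exact hacc.resolv_add_apply hs y
    exact this
  · intro x
    have h1 : realShift A s x = s • (x : H) + A ⟨x, x.2⟩ := rfl
    have h2 : B (A ⟨x, x.2⟩) = x := hB.2 ⟨x, x.2⟩
    rw [h1]
    nth_rw 1 [← h2]
    have : (B * resolv B s) (s • B (A ⟨x, x.2⟩) + A ⟨x, x.2⟩)
        = B (resolv B s (A ⟨x, x.2⟩ + s • B (A ⟨x, x.2⟩))) := by rw [add_comm]; rfl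
    rw [this, hacc.resolv_apply_add hs, h2]

lemma continuousOn_mul_resolv (hacc : IsAccretive B) :
    ContinuousOn (fun s => B * resolv B s) (Set.Ioi 0) := by
  intro s hs
  have hs : 0 < s := hs
  obtain ⟨u, hu⟩ := hacc.isUnit_one_add_smul hs.le
  have h1 : ContinuousAt (fun s : ℝ => (1 : H →L[ℝ] H) + s • B) s := by fun_prop
  have h2 : ContinuousAt Ring.inverse ((1 : H →L[ℝ] H) + s • B) := by
    rw [← hu]; exact NormedRing.inverse_continuousAt u
  exact (continuousAt_const.mul (ContinuousAt.comp (f := fun s : ℝ => (1 : H →L[ℝ] H) + s • B)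
    h2 h1)).continuousWithinAt

/-- Interpolation between `‖X‖` and `‖X A⁻¹‖` along the powers of `A`, uniformly in the exponent. -/
lemma norm_comp_negPow_le (hB : IsBoundedInverse A B) (hacc : IsAccretive B) {X : H →L[ℝ] H}
    {a b θ : ℝ} (ha : 0 < a) (hb : 0 < b) (hXB : ‖X * B‖ ≤ a) (hX : ‖X‖ ≤ b)
    (hθ : θ ∈ Set.Icc (0 : ℝ) 1) : ‖X ∘L negPow A θ‖ ≤ 2 * (a ^ θ * b ^ (1 - θ)) := by
  rw [negPow]
  split_ifs with h0 h1
  · rw [h0]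
    have : X ∘L (1 : H →L[ℝ] H) = X := mul_one X
    rw [this]
    norm_num
    linarith
  · rw [h1, hB.boundedInverse_eq]
    norm_num
    exact hXB.trans (by linarith)
  have hθ0 : 0 < θ := lt_of_le_of_ne hθ.1 (Ne.symm h0)
  have hθ1 : θ < 1 := lt_of_le_of_ne hθ.2 h1
  have hinv : ∀ s ∈ Set.Ioi (0 : ℝ), s ^ (-θ) • boundedInverse (realShift A s)
      = s ^ (-θ) • (B * resolv B s) := fun s hs => by
    rw [(isBoundedInverse_realShift hB hacc (le_of_lt hs)).boundedInverse_eq]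
  rw [setIntegral_congr_fun measurableSet_Ioi hinv]
  have bd : ∀ (Y : H →L[ℝ] H) (a b : ℝ), ‖Y * B‖ ≤ a → ‖Y‖ ≤ b → ∀ s : ℝ, 0 < s →
      ‖Y * (B * resolv B s)‖ ≤ a ∧ ‖Y * (B * resolv B s)‖ ≤ b / s := by
    intro Y a b ha hb s hs
    constructor
    · rw [← mul_assoc]
      exact (norm_mul_le_of_le ha (hacc.norm_resolv_le hs.le)).trans (by rw [mul_one])
    · have e : Y * (B * resolv B s) = s⁻¹ • (Y * (1 - resolv B s)) := by
        rw [← hacc.smul_mul_resolv hs.le, smul_mul_assoc, mul_smul_comm, inv_smul_smul₀ hs.ne']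
      rw [e, norm_smul, Real.norm_of_nonneg (by positivity), inv_mul_eq_div]
      gcongr
      exact (norm_mul_le_of_le hb (hacc.norm_one_sub_resolv_le hs.le)).trans (by rw [mul_one])
  have hint : IntegrableOn (fun s : ℝ => s ^ (-θ) • (B * resolv B s)) (Set.Ioi 0) := by
    have hb' := bd 1 (‖B‖ + 1) 1 (by rw [one_mul]; linarith) ContinuousLinearMap.norm_id_le
    simp only [one_mul] at hb'
    exact (integrableOn_rpow_smul_and_norm_le (continuousOn_mul_resolv hacc) (by positivity)
      one_pos hθ0 hθ1 (fun s hs => (hb' s hs).1) (fun s hs => (hb' s hs).2)).1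
  have hcomm : X ∘L ((Real.sin (Real.pi * θ) / Real.pi) •
        ∫ s in Set.Ioi (0 : ℝ), s ^ (-θ) • (B * resolv B s))
      = (Real.sin (Real.pi * θ) / Real.pi) •
        ∫ s in Set.Ioi (0 : ℝ), s ^ (-θ) • (X * (B * resolv B s)) := by
    have h := (ContinuousLinearMap.compL ℝ H H H X).integral_comp_comm hint
    rw [ContinuousLinearMap.comp_smul]
    congr 1
    refine h.symm.trans ?_
    congr 1
    funext s
    rw [map_smul]
    rfl
  rw [hcomm]
  exact (integrableOn_rpow_smul_and_norm_le (continuousOn_const.mul (continuousOn_mul_resolv hacc))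
    ha hb hθ0 hθ1 (fun s hs => (bd X a b hXB hX s hs).1) (fun s hs => (bd X a b hXB hX s hs).2)).2

end PositiveOperator

/-! ### The discrete operators -/

namespace SpatialDiscretization

variable {H : Type*} [NormedAddCommGroup H] [InnerProductSpace ℝ H]
  (D : SpatialDiscretization H)

section Lift

variable (h : D.I) (S T : D.V h →L[ℝ] D.V h)

lemma lift_apply (x : H) : D.lift h T x = T (D.P h x) := rfl

lemma lift_mul : D.lift h S * D.lift h T = D.lift h (S * T) := by
  ext x
  have : D.P h (T (D.P h x) : H) = T (D.P h x) := D.P_proj h _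
  simp [lift_apply, this]

lemma lift_pow_succ (n : ℕ) : D.lift h T ^ (n + 1) = D.lift h (T ^ (n + 1)) := by
  induction n with
  | zero => simp
  | succ n ih => rw [pow_succ, ih, lift_mul, ← pow_succ]

lemma lift_sub : D.lift h (S - T) = D.lift h S - D.lift h T := by
  ext x; simp [lift_apply]

lemma lift_add : D.lift h (S + T) = D.lift h S + D.lift h T := by
  ext x; simp [lift_apply]

lemma lift_smul (c : ℝ) : D.lift h (c • T) = c • D.lift h T := by
  ext x; simp [lift_apply]

lemma norm_lift_le {c p : ℝ} (hT : ‖T‖ ≤ c) (hp : ‖D.P h‖ ≤ p) : ‖D.lift h T‖ ≤ c * p := by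
  have hc : 0 ≤ c := (norm_nonneg T).trans hT
  have hp0 : 0 ≤ p := (norm_nonneg (D.P h)).trans hp
  refine ContinuousLinearMap.opNorm_le_bound _ (by positivity) fun x => ?_
  rw [lift_apply, mul_assoc]
  exact (T.le_of_opNorm_le hT _).trans
    (mul_le_mul_of_nonneg_left ((D.P h).le_of_opNorm_le hp x) hc)

lemma norm_le_norm_lift : ‖T‖ ≤ ‖D.lift h T‖ := by
  refine ContinuousLinearMap.opNorm_le_bound _ (norm_nonneg _) fun v => ?_
  have := (D.lift h T).le_opNorm (v : H)
  rwa [lift_apply, D.P_proj h v] at this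

end Lift

lemma completeSpace (h : D.I) : CompleteSpace (D.V h) :=
  have := D.finiteDimensional h
  FiniteDimensional.complete ℝ (D.V h)

/-- The discrete implicit Euler step `(I + τ A_h)⁻¹ P_h`, as an operator on `H`. -/
noncomputable def euler (h : D.I) (τ : ℝ) : H →L[ℝ] H := D.lift h (resolv (D.Ah h) τ)

variable {D} {A A₁ A₂ : H →ₗ.[ℝ] H}

lemma propagator_sub_euler_pow (h : D.I) (τ : ℝ) {n : ℕ} (hn : 1 ≤ n) :
    D.propagator h τ n - D.euler h τ ^ n
      = D.lift h (drStep (D.Ah₁ h) (D.Ah₂ h) τ ^ (n - 1) * resolv (D.Ah₂ h) τ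
        * resolv (D.Ah₁ h) τ - resolv (D.Ah h) τ ^ n) := by
  obtain ⟨m, rfl⟩ : ∃ m, n = m + 1 := ⟨n - 1, by omega⟩
  rw [lift_sub, euler, lift_pow_succ]
  rfl

namespace DiscreteOperatorAssumption

variable (hD : D.DiscreteOperatorAssumption A A₁ A₂)
include hD

lemma isAccretive₁ (h : D.I) : IsAccretive (D.Ah₁ h) := fun v => hD.nonneg₁ h v

lemma isAccretive₂ (h : D.I) : IsAccretive (D.Ah₂ h) := fun v => hD.nonneg₂ h v

lemma isAccretive (h : D.I) : IsAccretive (D.Ah h) :=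
  isAccretive_of_add (hD.sum h) (hD.isAccretive₁ h) (hD.isAccretive₂ h)

lemma isUnit_Ah (h : D.I) : IsUnit (D.Ah h) := by
  have := D.completeSpace h
  obtain ⟨C, hC, hn⟩ := hD.norm_le
  obtain ⟨c, hc, hco⟩ := hD.coercive
  refine ContinuousLinearMap.isUnit_of_forall_le_norm_inner_map (𝕜 := ℝ) _
    (c := ⟨c / C ^ 2, by positivity⟩) (by change 0 < c / C ^ 2; positivity) fun v => ?_
  have h1 : ‖(v : H)‖ ^ 2 ≤ (C * D.normV h v) ^ 2 := by gcongr; exact hn h v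
  calc ‖v‖ ^ 2 * (c / C ^ 2) ≤ (C * D.normV h v) ^ 2 * (c / C ^ 2) :=
      mul_le_mul_of_nonneg_right h1 (by positivity)
    _ = c * D.normV h v ^ 2 := by field_simp
    _ ≤ inner ℝ (D.Ah h v : H) (v : H) := hco h v
    _ ≤ _ := Real.le_norm_self _

/-- The smoothing of the discrete implicit Euler steps, uniform in `h` and `τ`. -/
lemma exists_norm_resolv_pow_mul_le : ∃ M : ℝ, 1 ≤ M ∧ ∀ (h : D.I) (τ : ℝ), 0 ≤ τ → ∀ j : ℕ,
    ‖resolv (D.Ah h) τ ^ j * (1 - resolv (D.Ah h) τ)‖ ≤ M / (j + 1) := by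
  obtain ⟨C, hC, hbd⟩ := hD.bounded
  obtain ⟨c, hc, hco⟩ := hD.coercive
  refine ⟨1 + C / c, by have := div_pos hC hc; linarith, fun h τ hτ j => ?_⟩
  have := D.completeSpace h
  exact norm_pow_mul_one_sub_le (N := D.normV h) hc hC hτ (hco h) (hbd h)
    ((hD.isAccretive h).resolv_add_apply hτ) j

lemma isImplicitEuler_euler (h : D.I) {τ : ℝ} (hτ : 0 ≤ τ) :
    IsImplicitEuler τ (D.lift h (Ring.inverse (D.Ah h))) (D.euler h τ) := by
  have := D.completeSpace h
  have hE := isImplicitEuler_inverse_resolv (hD.isAccretive h) (hD.isUnit_Ah h) hτ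
  constructor
  · rw [euler, mul_sub, mul_one, lift_mul, ← lift_sub, ← lift_smul, ← hE.left, mul_sub, mul_one]
  · rw [euler, sub_mul, one_mul, lift_mul, ← lift_sub, ← lift_smul, ← hE.right, sub_mul, one_mul]

lemma exists_isSmoothing_euler (hP : D.ProjectionAssumption A) :
    ∃ M : ℝ, 1 ≤ M ∧ ∀ (h : D.I) (τ : ℝ), 0 ≤ τ → IsSmoothing M (D.euler h τ) := by
  obtain ⟨p, hp, hPb⟩ := hP.bounded
  obtain ⟨M, hM1, hM⟩ := hD.exists_norm_resolv_pow_mul_le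
  refine ⟨M * p + p + 1, by nlinarith, fun h τ hτ => ?_⟩
  have := D.completeSpace h
  have hacc := hD.isAccretive h
  have hMp : 0 ≤ M * p := by positivity
  refine ⟨fun j => ?_, fun j => ?_⟩
  · rcases j with _ | j
    · rw [pow_zero]
      exact ContinuousLinearMap.norm_id_le.trans (by linarith)
    · rw [euler, lift_pow_succ]
      refine (D.norm_lift_le h _ (norm_pow_le_one ContinuousLinearMap.norm_id_le
        (hacc.norm_resolv_le hτ) _) (hPb h)).trans (by linarith)
  · rcases j with _ | j
    · rw [pow_zero, one_mul]
      have h1 : ‖D.euler h τ‖ ≤ 1 * p := D.norm_lift_le h _ (hacc.norm_resolv_le hτ) (hPb h)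
      have h2 := norm_sub_le_of_le (a₁ := (1 : H →L[ℝ] H)) ContinuousLinearMap.norm_id_le h1
      refine h2.trans ?_
      norm_num
      linarith
    · have e : D.euler h τ ^ (j + 1) * (1 - D.euler h τ)
          = D.lift h (resolv (D.Ah h) τ ^ (j + 1) * (1 - resolv (D.Ah h) τ)) := by
        rw [mul_sub, mul_one, ← pow_succ, euler, lift_pow_succ, lift_pow_succ, ← lift_sub, mul_sub,
          mul_one, ← pow_succ]
      rw [e]
      refine (D.norm_lift_le h _ (hM h τ hτ (j + 1)) (hPb h)).trans ?_
      rw [div_mul_eq_mul_div]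
      gcongr
      linarith

/-- `A_{h,2} A_h⁻¹` is bounded uniformly in `h`: replacing `A_h⁻¹ P_h` by `A⁻¹` costs `h² h⁻²`,
and exchanging `A_{h,2}` for `A₂` costs a constant. -/
lemma exists_norm_Ah₂_mul_inverse_le (hA : SplitOperators A A₁ A₂)
    (hP : D.ProjectionAssumption A) :
    ∃ K : ℝ, 0 < K ∧ ∀ h : D.I, ‖D.Ah₂ h * Ring.inverse (D.Ah h)‖ ≤ K := by
  obtain ⟨p, hp, hPb⟩ := hP.bounded
  obtain ⟨G, hG⟩ := hA.bounded₂
  obtain ⟨C₁, hC₁, hinv⟩ := hD.inverseEstimate₂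
  obtain ⟨C₂, hC₂, hex⟩ := hD.exchange₂
  obtain ⟨C₃, hC₃, happ⟩ := hD.approx
  have hB := hA.sectorial.isBoundedInverse
  refine ⟨p * ‖G‖ + C₂ + C₁ * C₃, by positivity, fun h => (D.norm_le_norm_lift h _).trans ?_⟩
  have hh : 0 < (h : ℝ) := D.I_pos h h.2
  rw [← lift_mul]
  set B := boundedInverse A
  set Bh := D.lift h (Ring.inverse (D.Ah h))
  have e : D.lift h (D.Ah₂ h) * Bh = D.lift h (D.Ah₂ h) * B - D.lift h (D.Ah₂ h) * (B - Bh) := by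
    noncomm_ring
  rw [e]
  refine norm_sub_le_of_le (ContinuousLinearMap.opNorm_le_bound _ (by positivity) fun y => ?_) ?_
  · obtain ⟨hy, e1⟩ := hB.1 y
    obtain ⟨hv, h2⟩ := hex h ⟨B y, hy⟩
    obtain ⟨hv', h3⟩ := hG y
    rw [e1] at h2
    have h4 : ‖D.P h (A₂ ⟨B y, hv⟩)‖ ≤ p * (‖G‖ * ‖y‖) := by
      refine ((D.P h).le_of_opNorm_le (hPb h) _).trans ?_
      rw [h3]
      gcongr
      exact G.le_opNorm y
    have e2 : (D.lift h (D.Ah₂ h) * B) y = (D.P h (A₂ ⟨B y, hv⟩)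
        - (D.P h (A₂ ⟨B y, hv⟩) - D.Ah₂ h (D.P h (B y))) : D.V h) := by
      rw [sub_sub_cancel]; rfl
    rw [e2]
    exact (norm_sub_le_of_le h4 h2).trans (le_of_eq (by ring))
  · refine (norm_mul_le_of_le (hinv h) (happ h)).trans (le_of_eq ?_)
    field_simp

lemma exists_norm_propagator_le (hP : D.ProjectionAssumption A) :
    ∃ C : ℝ, 0 < C ∧ ∀ (h : D.I) (τ : ℝ), 0 ≤ τ → ∀ n : ℕ, ‖D.propagator h τ n‖ ≤ C := by
  obtain ⟨p, hp, hPb⟩ := hP.bounded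
  refine ⟨1 * p, by positivity, fun h τ hτ n => ?_⟩
  have := D.completeSpace h
  exact D.norm_lift_le h _ (norm_drStep_pow_mul_resolv_le (hD.isAccretive₁ h) (hD.isAccretive₂ h)
    hτ (n - 1)) (hPb h)

/-- The difference of the scheme and implicit Euler, for smooth data of the continuous problem.
After `A_h⁻¹ P_h` it is of size `(1 + ln n) τ`, hence by itself of size `(1 + ln n) τ h⁻²`; the
latter factor `h⁻²` is absorbed by `A⁻¹ - A_h⁻¹ P_h = O(h²)`. -/
lemma exists_norm_propagator_sub_mul_le (hA : SplitOperators A A₁ A₂)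
    (hP : D.ProjectionAssumption A) :
    ∃ C : ℝ, 0 < C ∧ ∀ (h : D.I) (τ : ℝ), 0 ≤ τ → ∀ n : ℕ, 1 ≤ n →
      ‖(D.propagator h τ n - D.euler h τ ^ n) * boundedInverse A‖
        ≤ C * ((1 + Real.log n) * τ) := by
  obtain ⟨p, hp, hPb⟩ := hP.bounded
  obtain ⟨M, hM1, hM⟩ := hD.exists_norm_resolv_pow_mul_le
  obtain ⟨K, hK, hKb⟩ := hD.exists_norm_Ah₂_mul_inverse_le hA hP
  obtain ⟨C₁, hC₁, hinv₁⟩ := hD.inverseEstimate₁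
  obtain ⟨C₂, hC₂, hinv₂⟩ := hD.inverseEstimate₂
  obtain ⟨C₃, hC₃, happ⟩ := hD.approx
  refine ⟨2 * K * M * p * (1 + (C₁ + C₂) * C₃), by positivity, fun h τ hτ n hn => ?_⟩
  have := D.completeSpace h
  have hh : 0 < (h : ℝ) := D.I_pos h h.2
  have hu := hD.isUnit_Ah h
  rw [propagator_sub_euler_pow h τ hn]
  set Q := Ring.inverse (D.Ah h) with hQ
  set F := drStep (D.Ah₁ h) (D.Ah₂ h) τ ^ (n - 1) * resolv (D.Ah₂ h) τ
        * resolv (D.Ah₁ h) τ - resolv (D.Ah h) τ ^ n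
  have hcomm : Commute Q (resolv (D.Ah h) τ) :=
    (isImplicitEuler_inverse_resolv (hD.isAccretive h) hu hτ).comm
  have hFQ : ‖D.lift h (F * Q)‖ ≤ 2 * K * M * ((1 + Real.log n) * τ) * p :=
    D.norm_lift_le h _ (norm_drStep_pow_mul_sub_mul_le (hD.sum h) (hD.isAccretive₁ h)
      (hD.isAccretive₂ h) hτ hcomm (hKb h) hM1 (hM h τ hτ) hn) (hPb h)
  have hF : D.lift h F = D.lift h (F * Q) * D.lift h (D.Ah h) := by
    rw [lift_mul, mul_assoc, hQ, Ring.inverse_mul_cancel _ hu, mul_one]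
  have hAh : ‖D.lift h (D.Ah h)‖ ≤ (C₁ + C₂) * ((h : ℝ) ^ 2)⁻¹ := by
    rw [hD.sum h, lift_add, add_mul]
    exact norm_add_le_of_le (hinv₁ h) (hinv₂ h)
  have e : D.lift h F * boundedInverse A = D.lift h (F * Q)
      + D.lift h (F * Q) * (D.lift h (D.Ah h) * (boundedInverse A - D.lift h Q)) := by
    rw [← mul_assoc, ← hF, mul_sub, lift_mul]; abel
  rw [e]
  refine (norm_add_le_of_le hFQ (norm_mul_le_of_le hFQ (norm_mul_le_of_le hAh (happ h)))).trans
    (le_of_eq ?_)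
  field_simp

end DiscreteOperatorAssumption

end SpatialDiscretization

/-! ### The error estimate -/

section Assembly

/-- `q ↦ min 1 q` is bounded by every power of `q` with an exponent in `[0, 1]`. -/
lemma le_mul_rpow_of_le_of_le_mul {x C q s : ℝ} (hC : 0 ≤ C) (hq : 0 < q)
    (hs : s ∈ Set.Icc (0 : ℝ) 1) (h1 : x ≤ C) (h2 : x ≤ C * q) : x ≤ C * q ^ s := by
  rcases le_total q 1 with h | h
  · refine h2.trans (mul_le_mul_of_nonneg_left ?_ hC)
    simpa using Real.rpow_le_rpow_of_exponent_ge hq h hs.2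
  · refine h1.trans ?_
    have := Real.one_le_rpow h hs.1
    nlinarith

lemma min_one_le_rpow {q₀ q s : ℝ} (hq₀ : 0 < q₀) (hq : q₀ ≤ q) (hs : s ∈ Set.Icc (0 : ℝ) 1) :
    min 1 q₀ ≤ q ^ s := by
  have h := le_mul_rpow_of_le_of_le_mul (x := min 1 q₀) zero_le_one (hq₀.trans_le hq) hs
    (min_le_left _ _) (by rw [one_mul]; exact (min_le_right _ _).trans hq)
  rwa [one_mul] at h

lemma rpow_mul_rpow_eq {t h θ ζ : ℝ} (ht : 0 < t) (hh : 0 < h) :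
    t ^ (-(ζ * (1 - θ))) * h ^ (2 * θ + 2 * ζ * (1 - θ))
      = (h ^ 2) ^ θ * (h ^ 2 / t) ^ (ζ * (1 - θ)) := by
  rw [Real.rpow_add hh, Real.div_rpow (by positivity) ht.le, Real.rpow_neg ht.le,
    ← Real.rpow_natCast_mul hh.le, ← Real.rpow_natCast_mul hh.le]
  push_cast
  rw [← mul_assoc]
  field_simp

lemma rpow_mul_rpow_eq_mul {a b K θ : ℝ} (hK : 1 ≤ K) (ha : 0 ≤ a) (hb : 0 ≤ b) :
    (K * a) ^ θ * (K * b) ^ (1 - θ) = K * (a ^ θ * b ^ (1 - θ)) := by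
  have hK0 : 0 < K := by linarith
  rw [Real.mul_rpow hK0.le ha, Real.mul_rpow hK0.le hb]
  have : K ^ θ * K ^ (1 - θ) = K := by rw [← Real.rpow_add hK0]; simp
  calc _ = (K ^ θ * K ^ (1 - θ)) * (a ^ θ * b ^ (1 - θ)) := by ring
    _ = _ := by rw [this]

variable {H : Type*} [NormedAddCommGroup H] [InnerProductSpace ℝ H] [CompleteSpace H]
  {A A₁ A₂ : H →ₗ.[ℝ] H} {D : SpatialDiscretization H}

namespace SpatialDiscretization

lemma DiscreteOperatorAssumption.norm_eulerStep_sub_euler_le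
    (hD : D.DiscreteOperatorAssumption A A₁ A₂) (hacc : IsAccretive (boundedInverse A))
    {M C τ : ℝ} (hτ : 0 < τ) {h : D.I} (hM : IsSmoothing M (D.euler h τ))
    (hC : ‖boundedInverse A - D.lift h (Ring.inverse (D.Ah h))‖ ≤ C * (h : ℝ) ^ 2) :
    ‖eulerStep (boundedInverse A) τ - D.euler h τ‖ ≤ M * C * τ⁻¹ * (h : ℝ) ^ 2 := by
  have e := (isImplicitEuler_eulerStep hacc hτ).smul_sub_eq (hD.isImplicitEuler_euler h hτ.le)
  have h1 : ‖1 - D.euler h τ‖ ≤ M := by simpa using hM.diff_le 0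
  have h2 : ‖1 - eulerStep (boundedInverse A) τ‖ ≤ 1 := by
    rw [eulerStep, sub_sub_cancel]; exact hacc.norm_resolv_le (by positivity)
  have h3 := norm_mul₃_le_of_le h1 hC h2
  rw [← e, norm_smul, Real.norm_of_nonneg hτ.le] at h3
  rw [← mul_le_mul_iff_right₀ hτ]
  refine h3.trans (le_of_eq ?_)
  field_simp

/-- If the discretization can be refined indefinitely, the smoothing of the discrete implicit Euler
steps is inherited by the implicit Euler steps of the continuous problem. -/
lemma DiscreteOperatorAssumption.isSmoothing_eulerStep
    (hD : D.DiscreteOperatorAssumption A A₁ A₂) (hacc : IsAccretive (boundedInverse A))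
    (hI : ∀ ε : ℝ, 0 < ε → ∃ h : D.I, (h : ℝ) < ε) {M τ : ℝ} (hM1 : 1 ≤ M) (hτ : 0 < τ)
    (hM : ∀ h : D.I, IsSmoothing M (D.euler h τ)) :
    IsSmoothing M (eulerStep (boundedInverse A) τ) := by
  obtain ⟨C, hC, happ⟩ := hD.approx
  choose h hh using fun n : ℕ => hI (1 / (n + 1)) (by positivity)
  have hh0 : Tendsto (fun n => ((h n : D.I) : ℝ)) atTop (𝓝 0) :=
    squeeze_zero (fun n => (D.I_pos _ (h n).2).le) (fun n => (hh n).le)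
      tendsto_one_div_add_atTop_nhds_zero_nat
  have hlim : Tendsto (fun n => D.euler (h n) τ) atTop (𝓝 (eulerStep (boundedInverse A) τ)) := by
    rw [tendsto_iff_norm_sub_tendsto_zero]
    refine squeeze_zero (fun _ => norm_nonneg _) (fun n => ?_)
      (by simpa using (hh0.pow 2).const_mul (M * C * τ⁻¹))
    rw [norm_sub_rev]
    exact hD.norm_eulerStep_sub_euler_le hacc hτ (hM (h n)) (happ (h n))
  refine ⟨fun j => ?_, fun j => ?_⟩
  · exact (norm_pow_le_one ContinuousLinearMap.norm_id_le (norm_eulerStep_le hacc hτ) j).trans hM1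
  · exact le_of_tendsto ((hlim.pow j).mul (tendsto_const_nhds.sub hlim)).norm
      (Eventually.of_forall fun n => (hM (h n)).diff_le j)

end SpatialDiscretization

/-- The error estimate at `t = n τ ≤ tf`, with a constant that is uniform in all parameters and the
spatial term `t^{-ζ(1-θ)} h^{2θ+2ζ(1-θ)}` written as `(h²)^θ (h² / t)^{ζ(1-θ)}`. -/
def HasErrorBound (A : H →ₗ.[ℝ] H) (D : SpatialDiscretization H) (tf : ℝ) : Prop :=
  ∃ C : ℝ, 0 < C ∧ ∀ (h : D.I) (n : ℕ), 1 ≤ n → ∀ τ : ℝ, 0 < τ → n * τ ≤ tf →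
    ∀ θ ∈ Set.Icc (0 : ℝ) 1, ∀ ζ ∈ Set.Icc (0 : ℝ) 1,
      ‖(expNeg A (n * τ) - D.propagator h τ n) ∘L negPow A θ‖ ≤
        C * ((1 + Real.log n) * τ ^ θ
          + ((h : ℝ) ^ 2) ^ θ * ((h : ℝ) ^ 2 / (n * τ)) ^ (ζ * (1 - θ)))

/-- If `h` is bounded from below, the right-hand side of the estimate is, too, and stability is
all there is to prove. -/
lemma hasErrorBound_of_le (hA : SplitOperators A A₁ A₂) (hP : D.ProjectionAssumption A)
    (hD : D.DiscreteOperatorAssumption A A₁ A₂) {tf : ℝ} (htf : 0 < tf) {ε : ℝ} (hε : 0 < ε)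
    (hI : ∀ h : D.I, ε ≤ (h : ℝ)) : HasErrorBound A D tf := by
  have hB := hA.sectorial.isBoundedInverse
  have hacc := hA.sectorial.isAccretive_inverse hB
  have hd := hA.sectorial.denseRange_inverse hB
  obtain ⟨hT, hG⟩ := expNeg_spec hB hacc hd
  obtain ⟨C, hC, hprop⟩ := hD.exists_norm_propagator_le hP
  set B := boundedInverse A
  set m : ℝ := min 1 (ε ^ 2) * min 1 (ε ^ 2 / tf)
  have hm : 0 < m := mul_pos (lt_min one_pos (by positivity)) (lt_min one_pos (by positivity))
  have hb : 0 < 1 + C := by positivity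
  have hk : 1 ≤ ‖B‖ + 1 := by linarith [norm_nonneg B]
  refine ⟨2 * ((‖B‖ + 1) * (1 + C)) / m, by positivity, fun h n hn τ hτ hnτ θ hθ ζ hζ => ?_⟩
  have hnτ0 : 0 < n * τ := by positivity
  have hX : ‖expNeg A (n * τ) - D.propagator h τ n‖ ≤ 1 + C :=
    norm_sub_le_of_le (hT.norm_le_one hG hacc hd hnτ0.le) (hprop h τ hτ.le n)
  have hXB : ‖(expNeg A (n * τ) - D.propagator h τ n) * B‖ ≤ (‖B‖ + 1) * (1 + C) := by
    refine (norm_mul_le_of_le hX le_rfl).trans ?_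
    nlinarith
  have hζθ : ζ * (1 - θ) ∈ Set.Icc (0 : ℝ) 1 :=
    ⟨mul_nonneg hζ.1 (sub_nonneg.2 hθ.2), mul_le_one₀ hζ.2 (sub_nonneg.2 hθ.2) (by linarith [hθ.1])⟩
  have hle : ‖(expNeg A (n * τ) - D.propagator h τ n) ∘L negPow A θ‖
      ≤ 2 * ((‖B‖ + 1) * (1 + C)) := by
    have hX' := hX.trans (le_mul_of_one_le_left hb.le hk)
    refine (norm_comp_negPow_le hB hacc (by positivity) (by positivity) hXB hX' hθ).trans
      (le_of_eq ?_)
    rw [← Real.rpow_add (by positivity)]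
    simp
  have hrhs : m ≤ ((h : ℝ) ^ 2) ^ θ * ((h : ℝ) ^ 2 / (n * τ)) ^ (ζ * (1 - θ)) := by
    have h1 : ε ^ 2 ≤ (h : ℝ) ^ 2 := by gcongr; exact hI h
    refine mul_le_mul (min_one_le_rpow (by positivity) h1 hθ)
      (min_one_le_rpow (by positivity) ?_ hζθ) (le_min zero_le_one (by positivity)) ?_
    · gcongr
    · exact Real.rpow_nonneg (by positivity) _
  refine hle.trans ?_
  rw [div_mul_eq_mul_div, le_div_iff₀ hm]
  have hlog : 0 ≤ Real.log n := Real.log_natCast_nonneg _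
  have : 0 ≤ (1 + Real.log n) * τ ^ θ := by positivity
  gcongr
  linarith

/-- If `h` may tend to zero, implicit Euler is smoothing for both problems, and the errors in time
and in space are interpolated separately. -/
lemma hasErrorBound_of_exists_lt (hA : SplitOperators A A₁ A₂) (hP : D.ProjectionAssumption A)
    (hD : D.DiscreteOperatorAssumption A A₁ A₂) (tf : ℝ)
    (hI : ∀ ε : ℝ, 0 < ε → ∃ h : D.I, (h : ℝ) < ε) : HasErrorBound A D tf := by
  have hB := hA.sectorial.isBoundedInverse
  have hacc := hA.sectorial.isAccretive_inverse hB
  have hd := hA.sectorial.denseRange_inverse hB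
  obtain ⟨hT, hG⟩ := expNeg_spec hB hacc hd
  obtain ⟨Cp, hCp, hprop⟩ := hD.exists_norm_propagator_le hP
  obtain ⟨Cd, hCd, hdiff⟩ := hD.exists_norm_propagator_sub_mul_le hA hP
  obtain ⟨M, hM1, hM⟩ := hD.exists_isSmoothing_euler hP
  obtain ⟨Ca, hCa, happ⟩ := hD.approx
  set B := boundedInverse A
  set K₁ : ℝ := 2 + Cp + M + 4 * M + Cd with hK₁
  set K₂ : ℝ := 1 + M + 4 * M ^ 2 * Ca + 30 * (M ^ 2 + M ^ 3) * Ca with hK₂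
  have hM0 : 0 < M := by linarith
  have hK₁1 : 1 ≤ K₁ := by linarith
  have hK₂1 : 1 ≤ K₂ := by
    have : 0 ≤ 4 * M ^ 2 * Ca := by positivity
    have : 0 ≤ 30 * (M ^ 2 + M ^ 3) * Ca := by positivity
    linarith
  refine ⟨2 * K₁ + 2 * K₂, by positivity, fun h n hn τ hτ hnτ θ hθ ζ hζ => ?_⟩
  have hnτ0 : 0 < n * τ := by positivity
  have hh : 0 < (h : ℝ) := D.I_pos h h.2
  have hE := isImplicitEuler_eulerStep hacc hτ
  have hEh := hD.isImplicitEuler_euler h hτ.le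
  have hs := hD.isSmoothing_eulerStep hacc hI hM1 hτ fun h => hM h τ hτ.le
  have hsh := hM h τ hτ.le
  set r := eulerStep B τ
  set ρ := D.euler h τ
  have hr1 : ‖r ^ n‖ ≤ 1 :=
    norm_pow_le_one ContinuousLinearMap.norm_id_le (norm_eulerStep_le hacc hτ) n
  have hlog : 0 ≤ Real.log n := Real.log_natCast_nonneg _
  have hL : 0 < (1 + Real.log n) * τ := by positivity
  set X₁ := (expNeg A (n * τ) - r ^ n) - (D.propagator h τ n - ρ ^ n)
  set X₂ := r ^ n - ρ ^ n
  have e : (expNeg A (n * τ) - D.propagator h τ n) ∘L negPow A θ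
      = X₁ ∘L negPow A θ + X₂ ∘L negPow A θ := by
    rw [← ContinuousLinearMap.add_comp]
    congr 1
    simp only [X₁, X₂]
    abel
  -- the error in time, where `r` and `ρ` are compared with `e^{-τ A}` and with the scheme
  have h1 : ‖X₁ ∘L negPow A θ‖ ≤ 2 * K₁ * ((1 + Real.log n) * τ ^ θ) := by
    have hX : ‖X₁‖ ≤ K₁ * 1 := by
      refine (norm_sub_le_of_le
        (norm_sub_le_of_le (hT.norm_le_one hG hacc hd hnτ0.le) hr1)
        (norm_sub_le_of_le (hprop h τ hτ.le n) (hsh.pow_le n))).trans ?_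
      linarith
    have hXB : ‖X₁ * B‖ ≤ K₁ * ((1 + Real.log n) * τ) := by
      rw [sub_mul]
      refine (norm_sub_le_of_le
        (hT.norm_sub_pow_mul_le hG hacc hd hτ hE (norm_eulerStep_le hacc hτ) hM1 hs hn)
        (hdiff h τ hτ.le n hn)).trans ?_
      rw [← add_mul]
      gcongr
      linarith
    refine (norm_comp_negPow_le hB hacc (by positivity) (by positivity) hXB hX hθ).trans ?_
    rw [rpow_mul_rpow_eq_mul hK₁1 hL.le zero_le_one, Real.one_rpow, mul_one,
      Real.mul_rpow (by positivity) hτ.le, ← mul_assoc]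
    gcongr
    simpa using Real.rpow_le_rpow_of_exponent_le (by linarith : 1 ≤ 1 + Real.log n) hθ.2
  -- the error in space
  have h2 : ‖X₂ ∘L negPow A θ‖
      ≤ 2 * K₂ * (((h : ℝ) ^ 2) ^ θ * ((h : ℝ) ^ 2 / (n * τ)) ^ (ζ * (1 - θ))) := by
    have hq : 0 < (h : ℝ) ^ 2 / (n * τ) := by positivity
    have p1 : 0 ≤ 4 * M ^ 2 * Ca := by positivity
    have p2 : 0 ≤ 30 * (M ^ 2 + M ^ 3) * Ca := by positivity
    have hX : ‖X₂‖ ≤ K₂ * ((h : ℝ) ^ 2 / (n * τ)) ^ ζ := by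
      refine le_mul_rpow_of_le_of_le_mul (by positivity) hq hζ ?_ ?_
      · exact (norm_sub_le_of_le hr1 (hsh.pow_le n)).trans (by linarith)
      · refine (norm_pow_sub_pow_le hτ hE hEh hs hsh (happ h) hn).trans ?_
        rw [← mul_assoc, mul_div_assoc]
        gcongr
        linarith
    have hXB : ‖X₂ * B‖ ≤ K₂ * (h : ℝ) ^ 2 := by
      refine (norm_pow_sub_pow_mul_le hτ.ne' hE hEh hs hsh (happ h) n).trans ?_
      rw [← mul_assoc]
      gcongr
      linarith
    have hqζ : 0 < ((h : ℝ) ^ 2 / (n * τ)) ^ ζ := Real.rpow_pos_of_pos hq _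
    refine (norm_comp_negPow_le hB hacc (by positivity) (by positivity) hXB hX hθ).trans
      (le_of_eq ?_)
    rw [rpow_mul_rpow_eq_mul hK₂1 (by positivity) hqζ.le, ← Real.rpow_mul hq.le]
    ring
  rw [e]
  refine (norm_add_le_of_le h1 h2).trans ?_
  have q1 : 0 ≤ (1 + Real.log n) * τ ^ θ := by positivity
  have q2 : 0 ≤ ((h : ℝ) ^ 2) ^ θ * ((h : ℝ) ^ 2 / (n * τ)) ^ (ζ * (1 - θ)) := by positivity
  have q3 : 0 < K₁ := by linarith
  have q4 : 0 < K₂ := by linarith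
  nlinarith

end Assembly

end DRSplitting

theorem mainTheorem4 {H : Type*} [NormedAddCommGroup H] [InnerProductSpace ℝ H] [CompleteSpace H]
    (A A₁ A₂ : H →ₗ.[ℝ] H) (D : DRSplitting.SpatialDiscretization H)
    (hA : DRSplitting.SplitOperators A A₁ A₂)
    (hP : D.ProjectionAssumption A)
    (hD : D.DiscreteOperatorAssumption A A₁ A₂)
    (tf : ℝ) (htf : 0 < tf) :
    ∃ C : ℝ, 0 < C ∧ ∀ (h : D.I) (N n : ℕ), 1 ≤ n → n ≤ N →
      ∀ θ ∈ Set.Icc (0 : ℝ) 1, ∀ ζ ∈ Set.Icc (0 : ℝ) 1, ∀ τ t : ℝ, τ = tf / N → t = n * τ →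
        ‖(DRSplitting.expNeg A t - D.propagator h τ n) ∘L DRSplitting.negPow A θ‖ ≤
          C * ((1 + Real.log n) * τ ^ θ +
            t ^ (-(ζ * (1 - θ))) * (h : ℝ) ^ (2 * θ + 2 * ζ * (1 - θ))) := by
  have hE : DRSplitting.HasErrorBound A D tf := by
    by_cases hI : ∀ ε : ℝ, 0 < ε → ∃ h : D.I, (h : ℝ) < ε
    · exact DRSplitting.hasErrorBound_of_exists_lt hA hP hD tf hI
    · push Not at hI
      obtain ⟨ε, hε, hI⟩ := hI
      exact DRSplitting.hasErrorBound_of_le hA hP hD htf hε hI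
  obtain ⟨C, hC, hbd⟩ := hE
  refine ⟨C, hC, fun h N n hn hnN θ hθ ζ hζ τ t hτ ht => ?_⟩
  have hN : (0 : ℝ) < N := by exact_mod_cast hn.trans hnN
  have hτ0 : 0 < τ := by rw [hτ]; positivity
  have hnτ : n * τ ≤ tf := by
    have : (n : ℝ) ≤ N := by exact_mod_cast hnN
    calc n * τ ≤ N * τ := by gcongr
      _ = tf := by rw [hτ]; field_simp
  have ht0 : 0 < t := by rw [ht]; positivity
  rw [DRSplitting.rpow_mul_rpow_eq ht0 (D.I_pos h h.2), ht]
  exact hbd h n hn τ hτ0 hnτ θ hθ ζ hζ
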